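/- Let $K\ge 0$, $\mu=(\mu_1,\mu_2)^\top$ with $\mu_i>0$, and for $k=1,\dots,K$ let $\alpha_k=(\alpha_{kij})$ be a $2\times2$ matrix with entries $\ge 0$ and $\beta_k=\mathrm{Dg}(\beta_{k1},\beta_{k2})$ a diagonal matrix with positive diagonal entries. Let $N=(N_1,N_2)$ be a bivariate simple point process on $\mathbb R$ (locally finite, without common jumps of the two components) whose stochastic intensity with respect to its own history is $$\lambda_t=\mu+\sum_{k=1}^K\lambda_k(t),\qquad \lambda_k(t)_i=\sum_{j=1}^2\int_{(-\infty,t)}\alpha_{kij}\,e^{-\beta_{ki}(t-u)}\,dN_j(u),$$ that is, a multi-kernel exponential Hawkes process. Assume that it is in a steady state: the joint law of the components $(\lambda_1(t),\dots,\lambda_K(t))$ does not depend on $t$ and has finite second moments. Write $N_i(t)$ for the number of events of type $i$ in $(0,t]$. Put $$A=\Big(I-\sum_{k}\beta_k^{-1}\alpha_k\Big)^{-1}\mu\,E[\lambda_t^\top],\qquad B=\Big(I-\sum_{k}\beta_k^{-1}\alpha_k\Big)^{-1}\sum_{k}\beta_k^{-1}\Big(-\beta_k^{-1}\alpha_kA+E[\lambda_k(t)\lambda_t^\top]+\alpha_k\,\mathrm{Dg}(E[\lambda_t])\Big),$$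 where $\mathrm{Dg}(v)$ is the diagonal matrix with diagonal $v$; by the steady-state assumption these matrices do not depend on $t$. Then the matrix $I-\sum_k\beta_k^{-1}\alpha_k$ is invertible, $N_1(t)-N_2(t)$ is square integrable for every $t\ge0$, and, up to an additive constant and an exponentially decaying transient, $$\mathrm{Var}(N_1(t)-N_2(t))\approx\left(2\begin{bmatrix}1&-1\end{bmatrix}B\begin{bmatrix}1\\-1\end{bmatrix}+\begin{bmatrix}1&1\end{bmatrix}E[\lambda_t]\right)t .$$ Precisely: there are constants $c,C\in\mathbb R$ and $\gamma>0$ such that for all $t\ge0$ $$\left|\mathrm{Var}(N_1(t)-N_2(t))-\left(2\begin{bmatrix}1&-1\end{bmatrix}B\begin{bmatrix}1\\-1\end{bmatrix}+\begin{bmatrix}1&1\end{bmatrix}E[\lambda_t]\right)t-c\right|\le C\,e^{-\gamma t}.$$ -/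

import Mathlib

open MeasureTheory ProbabilityTheory
open scoped ENNReal

noncomputable section

namespace Hawkes

/-- A simple locally finite configuration of points on the line: `ν` is the counting measure of a
set of event times that has finitely many points in every bounded interval. -/
def IsConfiguration (ν : Measure ℝ) : Prop :=
  ∃ S : Set ℝ, (∀ a b : ℝ, (S ∩ Set.Icc a b).Finite) ∧ ν = Measure.count.restrict S

section Model

variable {Ω : Type*} [MeasurableSpace Ω]

/-- A bivariate simple point process on the whole line (a random measure for each of the two event
types, given as a measurable family of measures); the two types have no common event times. -/
structure IsPointProcess (N : Fin 2 → Kernel Ω ℝ) : Prop where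
  configuration : ∀ i ω, IsConfiguration (N i ω)
  no_common_events : ∀ ω t, N 0 ω {t} = 0 ∨ N 1 ω {t} = 0

/-- The internal history at time `t`: generated by the numbers of events of both types in all
intervals `(a, b]` with `b ≤ t`. -/
@[reducible] def history (N : Fin 2 → Kernel Ω ℝ) (t : ℝ) : MeasurableSpace Ω :=
  ⨆ (j : Fin 2) (a : ℝ) (b : ℝ) (_ : b ≤ t),
    MeasurableSpace.comap (fun ω => N j ω (Set.Ioc a b)) inferInstance

/-- The `i`-th entry of the component `λ_k(t) = ∫_{-∞}^t h_k(t - u) dN_u` for the kernel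
`h_k(t) = (α_{kij} e^{-β_{ki} t})_{ij}`. It is the left-continuous (predictable) version: only
events strictly before `t` contribute. As a sum of nonnegative terms it takes values in `[0, ∞]`. -/
def component {K : ℕ} (α : Fin K → Matrix (Fin 2) (Fin 2) ℝ) (β : Fin K → Fin 2 → ℝ)
    (N : Fin 2 → Kernel Ω ℝ) (k : Fin K) (i : Fin 2) (t : ℝ) (ω : Ω) : ℝ≥0∞ :=
  ∑ j : Fin 2, ∫⁻ u in Set.Iio t, ENNReal.ofReal (α k i j * Real.exp (-(β k i) * (t - u))) ∂(N j ω)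

/-- The `i`-th entry of the intensity `λ_t = μ + ∑_k λ_k(t)`. -/
def intensity {K : ℕ} (μ : Fin 2 → ℝ) (α : Fin K → Matrix (Fin 2) (Fin 2) ℝ)
    (β : Fin K → Fin 2 → ℝ) (N : Fin 2 → Kernel Ω ℝ) (i : Fin 2) (t : ℝ) (ω : Ω) : ℝ≥0∞ :=
  ENNReal.ofReal (μ i) + ∑ k : Fin K, component α β N k i t ω

/-- `N` is a bivariate Hawkes process on the whole line with base rates `μ` and the `K` exponential
kernels given by `α` and `β`: a point process whose stochastic intensity, relative to its history,
is `intensity μ α β N`, that is `E[N_i(s, t] | history s] = E[∫_s^t λ_i(u) du | history s]`. -/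
structure IsHawkes {K : ℕ} (μ : Fin 2 → ℝ) (α : Fin K → Matrix (Fin 2) (Fin 2) ℝ)
    (β : Fin K → Fin 2 → ℝ) (N : Fin 2 → Kernel Ω ℝ) (P : Measure Ω) : Prop where
  pointProcess : IsPointProcess N
  hasIntensity : ∀ (i : Fin 2) (s t : ℝ), s ≤ t → ∀ A : Set Ω, MeasurableSet[history N s] A →
    ∫⁻ ω in A, N i ω (Set.Ioc s t) ∂P =
      ∫⁻ ω in A, (∫⁻ u in Set.Ioc s t, intensity μ α β N i u ω) ∂P

/-- Steady state: the joint law of the (Markovian) vector of all intensity components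
`λ_{ki}(t)` does not depend on `t`, and it has finite second moments. -/
structure IsSteadyState {K : ℕ} (α : Fin K → Matrix (Fin 2) (Fin 2) ℝ)
    (β : Fin K → Fin 2 → ℝ) (N : Fin 2 → Kernel Ω ℝ) (P : Measure Ω) : Prop where
  identDistrib : ∀ t : ℝ, IdentDistrib (fun ω (k : Fin K) (i : Fin 2) => component α β N k i t ω)
    (fun ω (k : Fin K) (i : Fin 2) => component α β N k i 0 ω) P P
  secondMoment : ∀ (k : Fin K) (i : Fin 2), ∫⁻ ω, (component α β N k i 0 ω) ^ 2 ∂P < ∞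

/-- The counting process `N_i(t)`, the number of events of type `i` in `(0, t]`. -/
def count (N : Fin 2 → Kernel Ω ℝ) (i : Fin 2) (t : ℝ) (ω : Ω) : ℝ :=
  (N i ω (Set.Ioc 0 t)).toReal

/-- The vector `E[λ_t]`. -/
def meanIntensity {K : ℕ} (μ : Fin 2 → ℝ) (α : Fin K → Matrix (Fin 2) (Fin 2) ℝ)
    (β : Fin K → Fin 2 → ℝ) (N : Fin 2 → Kernel Ω ℝ) (P : Measure Ω) (t : ℝ) : Fin 2 → ℝ :=
  fun i => ∫ ω, (intensity μ α β N i t ω).toReal ∂P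

/-- The matrix `E[λ_k(t) λ_tᵀ]`. -/
def crossMoment {K : ℕ} (μ : Fin 2 → ℝ) (α : Fin K → Matrix (Fin 2) (Fin 2) ℝ)
    (β : Fin K → Fin 2 → ℝ) (N : Fin 2 → Kernel Ω ℝ) (P : Measure Ω) (k : Fin K) (t : ℝ) :
    Matrix (Fin 2) (Fin 2) ℝ :=
  Matrix.of fun i j => ∫ ω, (component α β N k i t ω).toReal * (intensity μ α β N j t ω).toReal ∂P

/-- The matrix `∑_k β_k⁻¹ α_k`, where `β_k = Dg(β_{k1}, β_{k2})`. -/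
def branching {K : ℕ} (α : Fin K → Matrix (Fin 2) (Fin 2) ℝ) (β : Fin K → Fin 2 → ℝ) :
    Matrix (Fin 2) (Fin 2) ℝ :=
  ∑ k : Fin K, (Matrix.diagonal (β k))⁻¹ * α k

/-- The matrix `A = (I - ∑_k β_k⁻¹ α_k)⁻¹ μ E[λ_tᵀ]`. -/
def matrixA {K : ℕ} (μ : Fin 2 → ℝ) (α : Fin K → Matrix (Fin 2) (Fin 2) ℝ)
    (β : Fin K → Fin 2 → ℝ) (N : Fin 2 → Kernel Ω ℝ) (P : Measure Ω) (t : ℝ) :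
    Matrix (Fin 2) (Fin 2) ℝ :=
  Matrix.vecMulVec (Matrix.mulVec (1 - branching α β)⁻¹ μ) (meanIntensity μ α β N P t)

/-- The matrix `B = (I - ∑_k β_k⁻¹ α_k)⁻¹
  ∑_k β_k⁻¹ (- β_k⁻¹ α_k A + E[λ_k(t) λ_tᵀ] + α_k Dg(E[λ_t]))`. -/
def matrixB {K : ℕ} (μ : Fin 2 → ℝ) (α : Fin K → Matrix (Fin 2) (Fin 2) ℝ)
    (β : Fin K → Fin 2 → ℝ) (N : Fin 2 → Kernel Ω ℝ) (P : Measure Ω) (t : ℝ) :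
    Matrix (Fin 2) (Fin 2) ℝ :=
  (1 - branching α β)⁻¹ * ∑ k : Fin K, (Matrix.diagonal (β k))⁻¹ *
    (-((Matrix.diagonal (β k))⁻¹ * α k * matrixA μ α β N P t) + crossMoment μ α β N P k t +
      α k * Matrix.diagonal (meanIntensity μ α β N P t))

end Model

end Hawkes

end

/-! Write `m` for the stationary mean intensity, X_aj(t) = E[N_a(0,t) λ_j(t)] and Y_aki(t) =
E[N_a(0,t) λ_ki(t)]. Everything rests on Campbell's formula: the mean of ∫ g(u) H_u dN_i(u) is ∫
g(u) E[H_u λ_i(u)] du when H_u depends only on the past of u. A product of two integrals against the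
process is split according to which event comes first. Each ordered part is then of Campbell type,
and the diagonal survives only for equal types, because events have mass one and the two types share
none (`IsHawkes.lintegral_mul`).

For two counts this gives E[N_a N_b] = ∫ X_ba + ∫ X_ab + δ_ab m_a t, hence the variance in terms of
the X_aj (`IsHawkes.variance_eq`). For a count times e^{β_ki t} λ_ki(t) it gives an integral
equation for Y_aki with the X_aj on the right (`IsHawkes.countComponent_eq`). Since X_aj = μ_j m_a t
+ ∑_k Y_akj, the system closes and is a linear Volterra system with nonnegative coupling.

The difference of the systems for a = 0 and a = 1 has an affine particular solution, apart from its
initial values, with slope m_j (m_0 - m_1) and constant term p = B(1,-1)ᵀ. The error solves the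
homogeneous system. It decays exponentially because m = μ + (∑ β_k⁻¹ α_k) m with μ > 0 supplies a
strict positive supersolution (`exists_abs_le_exp_of_volterra`). The same identity makes I - ∑ β_k⁻¹
α_k invertible. After integration the quadratic terms cancel against the squared mean, p gives the
slope 2(p_0 - p_1), and the diagonal gives m_0 + m_1.

None of this is available before the counts are known to be square integrable, which is not assumed:
it follows from the second moments of the intensity by truncation and absorption
(`IsHawkes.lintegral_count_sq`). -/

namespace Hawkes

/-! ### Random configurations, s-finiteness and measurability for the history -/

/-- A kernel on the line which is finite on bounded intervals, pointwise in the parameter, is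
s-finite. -/
theorem isSFiniteKernel_of_Ioc_lt_top {Ω : Type*} [MeasurableSpace Ω] (κ : Kernel Ω ℝ)
    (h : ∀ ω a b, κ ω (Set.Ioc a b) < ∞) : IsSFiniteKernel κ := by
  have hs : ∀ p : ℤ × ℕ, MeasurableSet {ω | (p.2 : ℝ≥0∞) ≤ κ ω (Set.Ioc (p.1 : ℝ) (p.1 + 1)) ∧
      κ ω (Set.Ioc (p.1 : ℝ) (p.1 + 1)) < (p.2 : ℝ≥0∞) + 1} := fun p => by
    have := κ.measurable_coe (measurableSet_Ioc (a := (p.1 : ℝ)) (b := p.1 + 1))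
    exact (measurableSet_le measurable_const this).inter (measurableSet_lt this measurable_const)
  classical
  -- The mass of a unit interval is finite for each ω but not uniformly in ω. Cutting Ω according to
  -- the integer part of that mass makes every piece a finite kernel.
  let κs : ℤ × ℕ → Kernel Ω ℝ := fun p =>
    Kernel.piecewise (hs p) (κ.restrict (measurableSet_Ioc (a := (p.1 : ℝ)) (b := p.1 + 1))) 0
  have hκs : ∀ p, IsFiniteKernel (κs p) := fun p => by
    refine ⟨⟨(p.2 : ℝ≥0∞) + 1, by finiteness, fun ω => ?_⟩⟩
    simp only [κs, Kernel.piecewise_apply']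
    split_ifs with hω
    · rw [Kernel.restrict_apply' _ _ _ MeasurableSet.univ, Set.univ_inter]
      exact hω.2.le
    · simp
  have hsum : κ = Kernel.sum κs := by
    ext ω B hB
    rw [Kernel.sum_apply' _ _ hB, ENNReal.summable.tsum_prod' fun _ => ENNReal.summable]
    have h1 : ∀ n : ℤ, ∑' m : ℕ, κs (n, m) ω B = κ ω (B ∩ Set.Ioc (n : ℝ) (n + 1)) := fun n => by
      set x := κ ω (Set.Ioc (n : ℝ) (n + 1)) with hx
      have hxt : x < ∞ := h _ _ _
      rw [tsum_eq_single ⌊x.toReal⌋₊]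
      · simp only [κs, Kernel.piecewise_apply', Kernel.restrict_apply' _ _ _ hB]
        rw [if_pos]
        refine ⟨?_, ?_⟩
        · rw [← hx]
          calc ((⌊x.toReal⌋₊ : ℕ) : ℝ≥0∞) = ENNReal.ofReal (⌊x.toReal⌋₊ : ℝ) := by simp
            _ ≤ ENNReal.ofReal x.toReal :=
              ENNReal.ofReal_le_ofReal (Nat.floor_le ENNReal.toReal_nonneg)
            _ = x := ENNReal.ofReal_toReal hxt.ne
        · rw [← hx]
          calc x = ENNReal.ofReal x.toReal := (ENNReal.ofReal_toReal hxt.ne).symm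
            _ < ENNReal.ofReal (⌊x.toReal⌋₊ + 1 : ℝ) :=
              (ENNReal.ofReal_lt_ofReal_iff (by positivity)).2 (Nat.lt_floor_add_one _)
            _ = _ := by rw [ENNReal.ofReal_add (by positivity) zero_le_one]; simp
      · intro m hm
        simp only [κs, Kernel.piecewise_apply']
        rw [if_neg]
        · simp
        · rintro ⟨h1, h2⟩
          rw [← hx] at h1 h2
          refine hm ((Nat.floor_eq_iff ENNReal.toReal_nonneg).2 ⟨?_, ?_⟩).symm
          · simpa using ENNReal.toReal_mono hxt.ne h1
          · have := (ENNReal.toReal_lt_toReal hxt.ne (by finiteness)).2 h2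
            rwa [ENNReal.toReal_add (by finiteness) (by finiteness), ENNReal.toReal_natCast,
              ENNReal.toReal_one] at this
    simp_rw [h1]
    rw [← measure_iUnion]
    · rw [← Set.inter_iUnion, iUnion_Ioc_intCast, Set.inter_univ]
    · intro a b hab
      exact ((Set.pairwise_disjoint_Ioc_intCast ℝ) hab).mono Set.inter_subset_right
        Set.inter_subset_right
    · exact fun n => hB.inter measurableSet_Ioc
  rw [hsum]
  exact Kernel.isSFiniteKernel_sum (hκs := fun p => inferInstance)

/-- Two functions with the same integrals over the events of a sub-σ-algebra have the same
integrals against functions measurable for it. -/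
theorem lintegral_mul_eq_of_setLIntegral_eq {Ω : Type*} {m m0 : MeasurableSpace Ω} (hm : m ≤ m0)
    {P : Measure Ω} {f g Z : Ω → ℝ≥0∞} (hf : Measurable f) (hg : Measurable g)
    (h : ∀ A, MeasurableSet[m] A → ∫⁻ ω in A, f ω ∂P = ∫⁻ ω in A, g ω ∂P)
    (hZ : Measurable[m] Z) : ∫⁻ ω, Z ω * f ω ∂P = ∫⁻ ω, Z ω * g ω ∂P := by
  have hZ0 : Measurable Z := hZ.mono hm le_rfl
  -- The hypothesis says that the densities `f` and `g` define the same measure on the smaller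
  -- σ-algebra, and `Z` only sees that σ-algebra.
  have key : (P.withDensity f).trim hm = (P.withDensity g).trim hm := by
    refine @Measure.ext _ m _ _ fun A hA => ?_
    rw [trim_measurableSet_eq hm hA, trim_measurableSet_eq hm hA, withDensity_apply _ (hm _ hA),
      withDensity_apply _ (hm _ hA), h A hA]
  have e : ∀ f : Ω → ℝ≥0∞, Measurable f →
      ∫⁻ ω, Z ω * f ω ∂P = ∫⁻ ω, Z ω ∂((P.withDensity f).trim hm) := fun f hf => by
    rw [lintegral_trim hm hZ, lintegral_withDensity_eq_lintegral_mul _ hf hZ0]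
    exact lintegral_congr fun ω => mul_comm _ _
  rw [e f hf, e g hg, key]

namespace IsConfiguration

variable {ν : Measure ℝ}

theorem measure_Ioc_lt_top (h : IsConfiguration ν) (a b : ℝ) : ν (Set.Ioc a b) < ∞ := by
  obtain ⟨S, hS, rfl⟩ := h
  rw [Measure.restrict_apply measurableSet_Ioc, Measure.count_apply_lt_top]
  exact (hS a b).subset fun x hx => ⟨hx.2, Set.Ioc_subset_Icc_self hx.1⟩

/-- A configuration charges its points with mass one. -/
theorem ae_singleton (h : IsConfiguration ν) : ∀ᵐ u ∂ν, ν {u} = 1 := by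
  obtain ⟨S, hS, rfl⟩ := h
  have hc : S.Countable := by
    have : S = ⋃ n : ℕ, S ∩ Set.Icc (-n : ℝ) n := by
      rw [← Set.inter_iUnion]
      refine (Set.inter_eq_left.2 fun x _ => ?_).symm
      obtain ⟨n, hn⟩ := exists_nat_ge |x|
      exact Set.mem_iUnion.2 ⟨n, abs_le.1 hn⟩
    rw [this]
    exact Set.countable_iUnion fun n => (hS _ _).countable
  filter_upwards [ae_restrict_mem hc.measurableSet] with u hu
  rw [Measure.restrict_apply (measurableSet_singleton u), Set.inter_eq_left.2 (by simpa using hu),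
    Measure.count_singleton]

end IsConfiguration

section Basic

variable {Ω : Type*} [MeasurableSpace Ω] {N : Fin 2 → Kernel Ω ℝ}

theorem IsPointProcess.isSFiniteKernel (h : IsPointProcess N) (j : Fin 2) :
    IsSFiniteKernel (N j) :=
  isSFiniteKernel_of_Ioc_lt_top _ fun ω a b => (h.configuration j ω).measure_Ioc_lt_top a b

theorem history_le (N : Fin 2 → Kernel Ω ℝ) (t : ℝ) : history N t ≤ ‹MeasurableSpace Ω› := by
  refine iSup_le fun j => iSup_le fun a => iSup_le fun b => iSup_le fun _ => ?_
  exact measurable_iff_comap_le.1 ((N j).measurable_coe measurableSet_Ioc)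

theorem history_mono (N : Fin 2 → Kernel Ω ℝ) {s t : ℝ} (h : s ≤ t) :
    history N s ≤ history N t :=
  iSup_mono fun _ => iSup_mono fun _ => iSup_mono fun _ => iSup_mono' fun hb => ⟨hb.trans h, le_rfl⟩

theorem measurable_history_Ioc (N : Fin 2 → Kernel Ω ℝ) (j : Fin 2) {a b t : ℝ} (h : b ≤ t) :
    Measurable[history N t] fun ω => N j ω (Set.Ioc a b) := by
  refine measurable_iff_comap_le.2 ?_
  exact le_iSup_of_le j (le_iSup_of_le a (le_iSup_of_le b (le_iSup_of_le h le_rfl)))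

/-- Integrals over the past are measurable for the history. -/
theorem IsPointProcess.measurable_history_lintegral (h : IsPointProcess N) (j : Fin 2) (t : ℝ)
    {f : ℝ → ℝ≥0∞} (hf : Measurable f) :
    Measurable[history N t] fun ω => ∫⁻ u in Set.Iic t, f u ∂(N j ω) := by
  -- The history is generated by masses of intervals, which form a π-system. The cut at -n provides
  -- the finite measures that the π-λ argument requires; monotone convergence removes it.
  have key : ∀ n : ℕ, Measurable[history N t] fun ω => (N j ω).restrict (Set.Ioc (-n : ℝ) t) := by
    intro n
    have hfin : ∀ ω, IsFiniteMeasure ((N j ω).restrict (Set.Ioc (-n : ℝ) t)) := fun ω =>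
      ⟨by simpa using (h.configuration j ω).measure_Ioc_lt_top _ _⟩
    have hb : ∀ a b : ℝ, Measurable[history N t]
        fun ω => (N j ω).restrict (Set.Ioc (-n : ℝ) t) (Set.Ioc a b) := fun a b => by
      simp_rw [Measure.restrict_apply measurableSet_Ioc, Set.Ioc_inter_Ioc]
      exact measurable_history_Ioc N j (min_le_right _ _)
    refine @Measurable.measure_of_isPiSystem Ω ℝ (history N t) _ _ hfin _
      ((borel_eq_generateFrom_Ioc ℝ) ▸ BorelSpace.measurable_eq) ?_ ?_ ?_
    · convert! isPiSystem_Ioc (fun x : ℝ => x) (fun x : ℝ => x)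
    · rintro _ ⟨a, b, _, rfl⟩
      exact hb a b
    · simp_rw [Measure.restrict_apply_univ]
      exact measurable_history_Ioc N j le_rfl
  have hU : ∀ ω, ∫⁻ u in Set.Iic t, f u ∂(N j ω)
      = ⨆ n : ℕ, ∫⁻ u in Set.Ioc (-n : ℝ) t, f u ∂(N j ω) := fun ω => by
    have : Set.Iic t = ⋃ n : ℕ, Set.Ioc (-n : ℝ) t := by
      ext x
      simp only [Set.mem_Iic, Set.mem_iUnion, Set.mem_Ioc, exists_and_right]
      refine ⟨fun hx => ⟨?_, hx⟩, fun hx => hx.2⟩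
      obtain ⟨n, hn⟩ := exists_nat_gt (-x)
      exact ⟨n, by linarith⟩
    rw [this, setLIntegral_iUnion_of_directed]
    exact Monotone.directed_le fun m n hmn => Set.Ioc_subset_Ioc_left (by simpa using hmn)
  simp_rw [hU]
  refine Measurable.iSup fun n => ?_
  exact (Measure.measurable_lintegral hf).comp (key n)

end Basic

end Hawkes

/-! ### Campbell's formula by dyadic approximation -/

namespace Hawkes

/-- The left end point of the half-open dyadic interval of level `n` that contains `u`. -/
noncomputable def dyadicLeft (n : ℕ) (u : ℝ) : ℝ := (⌈u * 2 ^ n⌉ - 1) / 2 ^ n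

/-- The ceiling minus one, rather than the floor, keeps the inequality strict at dyadic points too.
Thus a process sampled at this point is known before u, and left continuity suffices for the limit.
-/
theorem dyadicLeft_lt (n : ℕ) (u : ℝ) : dyadicLeft n u < u := by
  rw [dyadicLeft, div_lt_iff₀ (by positivity)]
  linarith [Int.ceil_lt_add_one (u * 2 ^ n)]

theorem le_dyadicLeft_add (n : ℕ) (u : ℝ) : u ≤ dyadicLeft n u + 1 / 2 ^ n := by
  rw [dyadicLeft, ← add_div, le_div_iff₀ (by positivity)]
  linarith [Int.le_ceil (u * 2 ^ n)]

theorem dyadicLeft_mono (n : ℕ) : Monotone (dyadicLeft n) := fun u v h => by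
  unfold dyadicLeft
  gcongr

theorem monotone_dyadicLeft (u : ℝ) : Monotone fun n => dyadicLeft n u := by
  refine monotone_nat_of_le_succ fun n => ?_
  unfold dyadicLeft
  rw [pow_succ, ← mul_assoc, div_le_div_iff₀ (by positivity) (by positivity)]
  -- With x = u 2^n, the bound ⌈x⌉ < x + 1 gives 2⌈x⌉ - 2 < 2x ≤ ⌈2x⌉, and integrality gains the
  -- missing one.
  have h : 2 * ⌈u * 2 ^ n⌉ - 1 ≤ ⌈u * 2 ^ n * 2⌉ := by
    have h1 := Int.ceil_lt_add_one (u * 2 ^ n)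
    have h2 := Int.le_ceil (u * 2 ^ n * 2)
    have : ((2 * ⌈u * 2 ^ n⌉ - 2 : ℤ) : ℝ) < ⌈u * 2 ^ n * 2⌉ := by push_cast; linarith
    have := Int.cast_lt.1 this
    omega
  have h' : ((2 * ⌈u * 2 ^ n⌉ - 1 : ℤ) : ℝ) ≤ ⌈u * 2 ^ n * 2⌉ := Int.cast_le.2 h
  push_cast at h'
  have : (0 : ℝ) < 2 ^ n := by positivity
  nlinarith

theorem tendsto_dyadicLeft (u : ℝ) :
    Filter.Tendsto (fun n => dyadicLeft n u) Filter.atTop (nhds u) := by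
  have h : Filter.Tendsto (fun n : ℕ => u - 1 / (2 : ℝ) ^ n) Filter.atTop (nhds (u - 0)) := by
    refine tendsto_const_nhds.sub ?_
    simpa using tendsto_pow_atTop_nhds_zero_of_lt_one (r := (1 / 2 : ℝ)) (by norm_num) (by norm_num)
  rw [sub_zero] at h
  exact tendsto_of_tendsto_of_tendsto_of_le_of_le h tendsto_const_nhds
    (fun n => by have := le_dyadicLeft_add n u; simp only; linarith) fun n => (dyadicLeft_lt n u).le

theorem dyadicLeft_eq {n : ℕ} {k : ℤ} {u : ℝ}
    (h : u ∈ Set.Ioc (k • (1 / 2 ^ n : ℝ)) ((k + 1) • (1 / 2 ^ n : ℝ))) :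
    dyadicLeft n u = k • (1 / 2 ^ n : ℝ) := by
  have hp : (0 : ℝ) < 2 ^ n := by positivity
  simp only [zsmul_eq_mul, mul_one_div, Set.mem_Ioc, div_lt_iff₀ hp, le_div_iff₀ hp,
    Int.cast_add, Int.cast_one] at h
  have : ⌈u * 2 ^ n⌉ = k + 1 := Int.ceil_eq_iff.2 ⟨by push_cast; linarith, by push_cast; linarith⟩
  rw [dyadicLeft, this, zsmul_eq_mul]
  push_cast
  ring

/-- Continuity from the left, along increasing sequences, of an increasing process. -/
def LeftContinuousMono {Ω : Type*} (H : ℝ → Ω → ℝ≥0∞) : Prop :=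
  ∀ ω, Monotone (fun u => H u ω) ∧ ∀ (u : ℝ) (x : ℕ → ℝ), Monotone x → (∀ n, x n < u) →
    Filter.Tendsto x Filter.atTop (nhds u) → ⨆ n, H (x n) ω = H u ω

section Compensator

variable {Ω : Type*} [m0 : MeasurableSpace Ω] {P : Measure Ω} {F : ℝ → MeasurableSpace Ω}
  {κ₁ κ₂ : Kernel Ω ℝ}

/-- If two random measures have the same conditional means on intervals `(s, t]` given the past of
`s`, then so do all integrals over `(s, ∞)`. -/
theorem lintegral_mul_setLIntegral_Ioi_eq (hF : ∀ t, F t ≤ m0) (hFm : Monotone F)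
    (h : ∀ s t, s ≤ t → ∀ A, MeasurableSet[F s] A →
      ∫⁻ ω in A, κ₁ ω (Set.Ioc s t) ∂P = ∫⁻ ω in A, κ₂ ω (Set.Ioc s t) ∂P)
    (hfin : ∀ a b, ∫⁻ ω, κ₁ ω (Set.Ioc a b) ∂P < ∞) (s : ℝ) {g : ℝ → ℝ≥0∞} (hg : Measurable g)
    {Z : Ω → ℝ≥0∞} (hZ : Measurable[F s] Z) :
    ∫⁻ ω, Z ω * ∫⁻ u in Set.Ioi s, g u ∂(κ₁ ω) ∂P =
      ∫⁻ ω, Z ω * ∫⁻ u in Set.Ioi s, g u ∂(κ₂ ω) ∂P := by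
  have hmeas : ∀ κ : Kernel Ω ℝ, Measurable fun ω => ∫⁻ u in Set.Ioi s, g u ∂(κ ω) := fun κ => by
    simp_rw [← Kernel.restrict_apply κ measurableSet_Ioi]
    exact (Measure.measurable_lintegral hg).comp (Kernel.measurable _)
  refine lintegral_mul_eq_of_setLIntegral_eq (hF s) (hmeas κ₁) (hmeas κ₂) (fun A hA => ?_) hZ
  -- For fixed A, both sides are integrals of `g` against mean measures on the line, so it is enough
  -- to compare these measures on half-open intervals.
  have e : ∀ κ : Kernel Ω ℝ, ∫⁻ ω in A, (∫⁻ u in Set.Ioi s, g u ∂(κ ω)) ∂P =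
      ∫⁻ u, g u ∂((P.restrict A).bind (κ.restrict (measurableSet_Ioi (a := s)) : Kernel Ω ℝ)) := fun κ => by
    rw [Measure.lintegral_bind (Kernel.aemeasurable _) hg.aemeasurable]
    simp_rw [Kernel.restrict_apply]
  have e' : ∀ (κ : Kernel Ω ℝ) a b,
      (P.restrict A).bind (κ.restrict (measurableSet_Ioi (a := s)) : Kernel Ω ℝ) (Set.Ioc a b) =
      ∫⁻ ω in A, κ ω (Set.Ioc (max a s) b) ∂P := fun κ a b => by
    rw [Measure.bind_apply measurableSet_Ioc (Kernel.aemeasurable _)]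
    simp_rw [Kernel.restrict_apply' _ _ _ measurableSet_Ioc, Set.Ioc_inter_Ioi]
  rw [e, e]
  congr 1
  refine Measure.ext_of_Ioc' _ _ (fun a b _ => ?_) fun a b _ => ?_
  · rw [e']
    exact ((setLIntegral_le_lintegral _ _).trans_lt (hfin _ _)).ne
  · rw [e', e']
    -- After the cut at s the interval starts at `max a s`, and A belongs to the past of that time
    -- because the filtration increases.
    rcases le_total (max a s) b with hb | hb
    · exact h _ _ hb A (hFm (le_max_right _ _) _ hA)
    · simp [Set.Ioc_eq_empty_of_le hb]

/-- Sampling H at the left end of each dyadic cell gives step processes that increase to H, by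
monotonicity and left continuity. Monotone convergence therefore needs no domination. Each summand
has a factor fixed at the left end of its cell, the shape in which the conditional-mean identity
applies. -/
theorem lintegral_lintegral_mul_eq_iSup {H : ℝ → Ω → ℝ≥0∞} (hH : ∀ t, Measurable (H t))
    (hc : LeftContinuousMono H) (κ : Kernel Ω ℝ)
    {g : ℝ → ℝ≥0∞} (hg : Measurable g) :
    ∫⁻ ω, ∫⁻ u, g u * H u ω ∂(κ ω) ∂P = ⨆ n : ℕ, ∑' k : ℤ,
      ∫⁻ ω, H (k • (1 / 2 ^ n : ℝ)) ω * ∫⁻ u in Set.Ioi (k • (1 / 2 ^ n : ℝ)),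
        (Set.Iic ((k + 1) • (1 / 2 ^ n : ℝ))).indicator g u ∂(κ ω) ∂P := by
  have hgi : ∀ b, Measurable ((Set.Iic b).indicator g) := fun b => hg.indicator measurableSet_Iic
  have hmeas : ∀ a b, Measurable fun ω => ∫⁻ u in Set.Ioi a, (Set.Iic b).indicator g u ∂(κ ω) :=
    fun a b => by
      simp_rw [← Kernel.restrict_apply κ measurableSet_Ioi]
      exact (Measure.measurable_lintegral (hgi b)).comp (Kernel.measurable _)
  have step : ∀ n ω, ∫⁻ u, g u * H (dyadicLeft n u) ω ∂(κ ω) = ∑' k : ℤ,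
      H (k • (1 / 2 ^ n : ℝ)) ω * ∫⁻ u in Set.Ioi (k • (1 / 2 ^ n : ℝ)),
        (Set.Iic ((k + 1) • (1 / 2 ^ n : ℝ))).indicator g u ∂(κ ω) := fun n ω => by
    rw [← setLIntegral_univ, ← iUnion_Ioc_zsmul (show (0 : ℝ) < 1 / 2 ^ n by positivity),
      lintegral_iUnion (fun k => measurableSet_Ioc) (Set.pairwise_disjoint_Ioc_zsmul _)]
    refine tsum_congr fun k => ?_
    rw [setLIntegral_indicator measurableSet_Iic, Set.inter_comm, Set.Ioi_inter_Iic,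
      ← lintegral_const_mul _ hg]
    refine setLIntegral_congr_fun measurableSet_Ioc fun u hu => ?_
    simp only [dyadicLeft_eq hu, mul_comm]
  have hsup : ∀ ω, ∫⁻ u, g u * H u ω ∂(κ ω) =
      ⨆ n, ∫⁻ u, g u * H (dyadicLeft n u) ω ∂(κ ω) := fun ω => by
    rw [← lintegral_iSup]
    · refine lintegral_congr fun u => ?_
      rw [← ENNReal.mul_iSup, (hc ω).2 u _ (monotone_dyadicLeft u) (fun n => dyadicLeft_lt n u)
        (tendsto_dyadicLeft u)]
    · exact fun n => hg.mul (((hc ω).1.comp (dyadicLeft_mono n)).measurable)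
    · exact fun m n hmn u => mul_le_mul_right ((hc ω).1 (monotone_dyadicLeft u hmn)) _
  simp_rw [hsup]
  rw [lintegral_iSup]
  · refine iSup_congr fun n => ?_
    simp_rw [step]
    exact lintegral_tsum fun k => ((hH _).mul (hmeas _ _)).aemeasurable
  · intro n
    simp_rw [step]
    exact Measurable.tsum fun k => (hH _).mul (hmeas _ _)
  · exact fun m n hmn ω => lintegral_mono fun u =>
      mul_le_mul_right ((hc ω).1 (monotone_dyadicLeft u hmn)) _

/-- Campbell's formula: a random measure and its compensator give the same mean to the integral of
an increasing left-continuous adapted process times a deterministic function. -/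
theorem lintegral_lintegral_mul_eq_of_compensator (hF : ∀ t, F t ≤ m0) (hFm : Monotone F)
    (h : ∀ s t, s ≤ t → ∀ A, MeasurableSet[F s] A →
      ∫⁻ ω in A, κ₁ ω (Set.Ioc s t) ∂P = ∫⁻ ω in A, κ₂ ω (Set.Ioc s t) ∂P)
    (hfin : ∀ a b, ∫⁻ ω, κ₁ ω (Set.Ioc a b) ∂P < ∞) {g : ℝ → ℝ≥0∞} (hg : Measurable g)
    {H : ℝ → Ω → ℝ≥0∞} (hH : ∀ t, Measurable[F t] (H t)) (hc : LeftContinuousMono H) :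
    ∫⁻ ω, ∫⁻ u, g u * H u ω ∂(κ₁ ω) ∂P = ∫⁻ ω, ∫⁻ u, g u * H u ω ∂(κ₂ ω) ∂P := by
  have hH0 : ∀ t, Measurable (H t) := fun t => (hH t).mono (hF t) le_rfl
  rw [lintegral_lintegral_mul_eq_iSup hH0 hc κ₁ hg, lintegral_lintegral_mul_eq_iSup hH0 hc κ₂ hg]
  refine iSup_congr fun n => tsum_congr fun k => ?_
  exact lintegral_mul_setLIntegral_Ioi_eq hF hFm h hfin _ (hg.indicator measurableSet_Iic) (hH _)

end Compensator

end Hawkes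

/-! ### Increasing left-continuous processes and stochastic intensities -/

namespace Hawkes

namespace LeftContinuousMono

variable {Ω : Type*} {H G : ℝ → Ω → ℝ≥0∞}

theorem const (f : Ω → ℝ≥0∞) : LeftContinuousMono fun _ : ℝ => f :=
  fun _ => ⟨monotone_const, fun _ _ _ _ _ => ciSup_const⟩

theorem inf_const (hH : LeftContinuousMono H) (c : ℝ≥0∞) :
    LeftContinuousMono fun u ω => min (H u ω) c := fun ω =>
  ⟨fun _ _ h => min_le_min ((hH ω).1 h) le_rfl, fun u x hx hlt hlim => by
    have := iSup_inf_eq (fun n => H (x n) ω) c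
    rw [(hH ω).2 u x hx hlt hlim] at this
    exact this.symm⟩

theorem sum {ι : Type*} (s : Finset ι) {H : ι → ℝ → Ω → ℝ≥0∞}
    (hH : ∀ i, LeftContinuousMono (H i)) : LeftContinuousMono fun u ω => ∑ i ∈ s, H i u ω :=
  fun ω => ⟨fun _ _ h => Finset.sum_le_sum fun i _ => (hH i ω).1 h, fun u x hx hlt hlim => by
    have := ENNReal.finsetSum_iSup_of_monotone (s := s) (f := fun i n => H i (x n) ω)
      fun i => (hH i ω).1.comp hx
    refine this.symm.trans ?_
    exact Finset.sum_congr rfl fun i _ => (hH i ω).2 u x hx hlt hlim⟩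

theorem setLIntegral_Iio (ν : Ω → Measure ℝ) (f : ℝ → ℝ≥0∞) :
    LeftContinuousMono fun u ω => ∫⁻ w in Set.Iio u, f w ∂(ν ω) := fun ω =>
  ⟨fun _ _ h => lintegral_mono_set (Set.Iio_subset_Iio h), fun u x hx hlt hlim => by
    have : Set.Iio u = ⋃ n, Set.Iio (x n) := by
      ext y
      simp only [Set.mem_Iio, Set.mem_iUnion]
      exact ⟨fun hy => (hlim.eventually (lt_mem_nhds hy)).exists,
        fun ⟨n, hn⟩ => hn.trans (hlt n)⟩
    simp only [this]
    rw [setLIntegral_iUnion_of_directed]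
    exact Monotone.directed_le fun m n hmn => Set.Iio_subset_Iio (hx hmn)⟩

/-- An increasing left-continuous process is jointly measurable. -/
theorem measurable_uncurry [MeasurableSpace Ω] (hc : LeftContinuousMono H)
    (hH : ∀ u, Measurable (H u)) : Measurable fun p : ℝ × Ω => H p.1 p.2 := by
  have : (fun p : ℝ × Ω => H p.1 p.2) = fun p => ⨆ n, H (dyadicLeft n p.1) p.2 := by
    funext p
    exact ((hc p.2).2 p.1 _ (monotone_dyadicLeft _) (fun n => dyadicLeft_lt n _)
      (tendsto_dyadicLeft _)).symm
  rw [this]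
  refine Measurable.iSup fun n => ?_
  have h1 : Measurable fun q : ℤ × Ω => H ((q.1 - 1) / 2 ^ n) q.2 :=
    measurable_from_prod_countable_right fun k => hH ((k - 1) / 2 ^ n)
  have h2 : Measurable fun p : ℝ × Ω => ((⌈p.1 * 2 ^ n⌉ : ℤ), p.2) :=
    (Int.measurable_ceil.comp (measurable_fst.mul_const _)).prodMk measurable_snd
  exact h1.comp h2

end LeftContinuousMono

theorem measurable_uncurry_swap {Ω : Type*} [MeasurableSpace Ω] {f : ℝ → Ω → ℝ≥0∞}
    (hf : Measurable fun p : ℝ × Ω => f p.1 p.2) : Measurable (Function.uncurry fun ω u => f u ω) :=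
  hf.comp measurable_swap

/-- Campbell's formula for a random measure with a stochastic intensity. -/
theorem lintegral_lintegral_mul_eq_of_intensity {Ω : Type*} [m0 : MeasurableSpace Ω]
    {P : Measure Ω} [SFinite P] {F : ℝ → MeasurableSpace Ω} {κ : Kernel Ω ℝ} {f : ℝ → Ω → ℝ≥0∞}
    (hf : Measurable fun p : ℝ × Ω => f p.1 p.2) (hF : ∀ t, F t ≤ m0) (hFm : Monotone F)
    (h : ∀ s t, s ≤ t → ∀ A, MeasurableSet[F s] A →
      ∫⁻ ω in A, κ ω (Set.Ioc s t) ∂P = ∫⁻ ω in A, (∫⁻ u in Set.Ioc s t, f u ω) ∂P)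
    (hfin : ∀ a b, ∫⁻ ω, κ ω (Set.Ioc a b) ∂P < ∞) {g : ℝ → ℝ≥0∞} (hg : Measurable g)
    {H : ℝ → Ω → ℝ≥0∞} (hH : ∀ t, Measurable[F t] (H t)) (hc : LeftContinuousMono H) :
    ∫⁻ ω, ∫⁻ u, g u * H u ω ∂(κ ω) ∂P = ∫⁻ u, g u * ∫⁻ ω, H u ω * f u ω ∂P := by
  have hH0 : ∀ t, Measurable (H t) := fun t => (hH t).mono (hF t) le_rfl
  have hHm := hc.measurable_uncurry hH0
  have hf' := measurable_uncurry_swap hf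
  have hfu : ∀ u, Measurable (f u) := fun u => hf.comp measurable_prodMk_left
  have hfω : ∀ ω, Measurable fun u => f u ω := fun ω => hf.comp measurable_prodMk_right
  -- The compensator f(u) du, taken as a random measure in its own right; the comparison of two
  -- random measures then applies.
  obtain ⟨Λ, hΛ⟩ : ∃ Λ : Kernel Ω ℝ, ∀ ω, Λ ω = volume.withDensity fun u => f u ω :=
    ⟨Kernel.withDensity (Kernel.const Ω volume) (fun ω u => f u ω), fun ω => by
      rw [Kernel.withDensity_apply _ hf', Kernel.const_apply]⟩
  rw [lintegral_lintegral_mul_eq_of_compensator (κ₂ := Λ) hF hFm ?_ hfin hg hH hc]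
  · have : ∀ ω, ∫⁻ u, g u * H u ω ∂(Λ ω) = ∫⁻ u, g u * (H u ω * f u ω) :=
      fun ω => by
        have hgH : Measurable fun u => g u * H u ω := hg.mul (hc ω).1.measurable
        rw [hΛ, lintegral_withDensity_eq_lintegral_mul _ (hfω ω) hgH]
        refine lintegral_congr fun u => ?_
        simp only [Pi.mul_apply]
        ring
    simp_rw [this]
    rw [lintegral_lintegral_swap]
    · exact lintegral_congr fun u => lintegral_const_mul _ ((hH0 u).mul (hfu u))
    · have h3 : Measurable fun p : ℝ × Ω => g p.1 * (H p.1 p.2 * f p.1 p.2) := by fun_prop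
      exact (measurable_uncurry_swap (f := fun u ω => g u * (H u ω * f u ω)) h3).aemeasurable
  · intro s t hst A hA
    rw [h s t hst A hA]
    simp_rw [hΛ, withDensity_apply _ measurableSet_Ioc]

/-! ### Intensity components, stationarity and mean rates -/

noncomputable section Model

variable {Ω : Type*} [MeasurableSpace Ω] {P : Measure Ω}
  {K : ℕ} {μ : Fin 2 → ℝ} {α : Fin K → Matrix (Fin 2) (Fin 2) ℝ} {β : Fin K → Fin 2 → ℝ}
  {N : Fin 2 → Kernel Ω ℝ}

/-- The weight `α e^{β u}` of an event at time `u`. -/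
def weight (α : Fin K → Matrix (Fin 2) (Fin 2) ℝ) (β : Fin K → Fin 2 → ℝ) (k : Fin K)
    (i j : Fin 2) (u : ℝ) : ℝ≥0∞ :=
  ENNReal.ofReal (α k i j * Real.exp (β k i * u))

@[fun_prop]
theorem measurable_weight (k : Fin K) (i j : Fin 2) : Measurable (weight α β k i j) := by
  unfold weight
  fun_prop

/-- The intensity component multiplied by `e^{β t}`; it increases with time. -/
def accumulated (α : Fin K → Matrix (Fin 2) (Fin 2) ℝ) (β : Fin K → Fin 2 → ℝ)
    (N : Fin 2 → Kernel Ω ℝ) (k : Fin K) (i : Fin 2) (t : ℝ) (ω : Ω) : ℝ≥0∞ :=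
  ∑ j : Fin 2, ∫⁻ u in Set.Iio t, weight α β k i j u ∂(N j ω)

/-- A component decays between events and so is not monotone in time. Factoring out the
deterministic exponential leaves an increasing left-continuous process, to which Campbell's formula
applies. -/
theorem component_eq (k : Fin K) (i : Fin 2) (t : ℝ) (ω : Ω) :
    component α β N k i t ω =
      ENNReal.ofReal (Real.exp (-(β k i) * t)) * accumulated α β N k i t ω := by
  rw [component, accumulated, Finset.mul_sum]
  refine Finset.sum_congr rfl fun j _ => ?_
  rw [← lintegral_const_mul _ (measurable_weight k i j)]
  refine lintegral_congr fun u => ?_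
  rw [weight, ← ENNReal.ofReal_mul (Real.exp_pos _).le, mul_left_comm, ← Real.exp_add]
  congr 3
  ring

theorem accumulated_eq (k : Fin K) (i : Fin 2) (t : ℝ) (ω : Ω) :
    accumulated α β N k i t ω = ENNReal.ofReal (Real.exp (β k i * t)) * component α β N k i t ω := by
  rw [component_eq, ← mul_assoc, ← ENNReal.ofReal_mul (Real.exp_pos _).le, ← Real.exp_add]
  simp

theorem leftContinuousMono_accumulated (k : Fin K) (i : Fin 2) :
    LeftContinuousMono (accumulated α β N k i) :=
  LeftContinuousMono.sum _ fun j => LeftContinuousMono.setLIntegral_Iio (fun ω => N j ω) _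

theorem leftContinuousMono_Ioo (j : Fin 2) :
    LeftContinuousMono fun u ω => N j ω (Set.Ioo 0 u) := by
  have := LeftContinuousMono.setLIntegral_Iio (fun ω => N j ω) ((Set.Ioi 0).indicator 1)
  convert this using 3 with u ω
  rw [setLIntegral_indicator measurableSet_Ioi, Set.Ioi_inter_Iio]
  simp

theorem IsPointProcess.measurable_history_setLIntegral_Iio (h : IsPointProcess N) (j : Fin 2)
    (t : ℝ) {f : ℝ → ℝ≥0∞} (hf : Measurable f) :
    Measurable[history N t] fun ω => ∫⁻ u in Set.Iio t, f u ∂(N j ω) := by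
  have := h.measurable_history_lintegral j t (hf.indicator (measurableSet_Iio (a := t)))
  simp_rw [setLIntegral_indicator measurableSet_Iio,
    Set.inter_eq_left.2 (Set.Iio_subset_Iic_self (a := t))] at this
  exact this

theorem IsPointProcess.measurable_history_accumulated (h : IsPointProcess N) (k : Fin K)
    (i : Fin 2) (t : ℝ) : Measurable[history N t] (accumulated α β N k i t) :=
  Finset.measurable_fun_sum _ fun j _ =>
    h.measurable_history_setLIntegral_Iio j t (measurable_weight k i j)

theorem IsPointProcess.measurable_history_Ioo (h : IsPointProcess N) (j : Fin 2) (t : ℝ) :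
    Measurable[history N t] fun ω => N j ω (Set.Ioo 0 t) := by
  have := h.measurable_history_setLIntegral_Iio j t (f := (Set.Ioi 0).indicator 1)
    (measurable_one.indicator measurableSet_Ioi)
  simpa [setLIntegral_indicator measurableSet_Ioi, Set.Ioi_inter_Iio] using this

theorem IsPointProcess.measurable_accumulated (h : IsPointProcess N) (k : Fin K) (i : Fin 2) :
    Measurable fun p : ℝ × Ω => accumulated α β N k i p.1 p.2 :=
  (leftContinuousMono_accumulated k i).measurable_uncurry fun t =>
    (h.measurable_history_accumulated k i t).mono (history_le N t) le_rfl

theorem IsPointProcess.measurable_component (h : IsPointProcess N) (k : Fin K) (i : Fin 2) :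
    Measurable fun p : ℝ × Ω => component α β N k i p.1 p.2 := by
  simp_rw [component_eq]
  have := h.measurable_accumulated (α := α) (β := β) k i
  fun_prop

theorem IsPointProcess.measurable_intensity (h : IsPointProcess N) (i : Fin 2) :
    Measurable fun p : ℝ × Ω => intensity μ α β N i p.1 p.2 := by
  simp_rw [intensity]
  have := fun k => h.measurable_component (α := α) (β := β) k i
  fun_prop

theorem IsPointProcess.measurable_intensity_apply (h : IsPointProcess N) (i : Fin 2) (t : ℝ) :
    Measurable fun ω => intensity μ α β N i t ω := by
  have := fun k => h.measurable_component (α := α) (β := β) k i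
  have : ∀ k, Measurable fun ω => component α β N k i t ω := fun k =>
    (this k).comp measurable_prodMk_left
  simp_rw [intensity]
  fun_prop

/-- The only form in which equality of laws enters: moments of the components taken at one and the
same time are constant. Joint laws at several times are never needed. -/
theorem IsSteadyState.lintegral_eq (hS : IsSteadyState α β N P)
    {G : (Fin K → Fin 2 → ℝ≥0∞) → ℝ≥0∞} (hG : Measurable G) (t : ℝ) :
    ∫⁻ ω, G (fun k i => component α β N k i t ω) ∂P =
      ∫⁻ ω, G (fun k i => component α β N k i 0 ω) ∂P :=
  ((hS.identDistrib t).comp hG).lintegral_eq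

theorem sq_add_le (a b : ℝ≥0∞) : (a + b) ^ 2 ≤ 4 * a ^ 2 + 4 * b ^ 2 := by
  rcases le_total a b with h | h
  · calc (a + b) ^ 2 ≤ (b + b) ^ 2 := by gcongr
      _ = 4 * b ^ 2 := by ring
      _ ≤ _ := le_add_self
  · calc (a + b) ^ 2 ≤ (a + a) ^ 2 := by gcongr
      _ = 4 * a ^ 2 := by ring
      _ ≤ _ := le_self_add

theorem lintegral_sq_add_lt_top {f g : Ω → ℝ≥0∞} (hf : Measurable f)
    (h1 : ∫⁻ ω, f ω ^ 2 ∂P < ∞) (h2 : ∫⁻ ω, g ω ^ 2 ∂P < ∞) :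
    ∫⁻ ω, (f ω + g ω) ^ 2 ∂P < ∞ := by
  refine (lintegral_mono fun ω => sq_add_le (f ω) (g ω)).trans_lt ?_
  rw [lintegral_add_left (by fun_prop), lintegral_const_mul _ (by fun_prop),
    lintegral_const_mul' _ _ (by finiteness)]
  finiteness

theorem IsSteadyState.lintegral_component_sq (hS : IsSteadyState α β N P) (k : Fin K) (i : Fin 2)
    (t : ℝ) : ∫⁻ ω, component α β N k i t ω ^ 2 ∂P < ∞ := by
  rw [hS.lintegral_eq (G := fun x => x k i ^ 2) (by fun_prop) t]
  exact hS.secondMoment k i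

theorem IsSteadyState.lintegral_intensity_sq [IsProbabilityMeasure P] (hN : IsPointProcess N) (hS : IsSteadyState α β N P)
    (i : Fin 2) (t : ℝ) : ∫⁻ ω, intensity μ α β N i t ω ^ 2 ∂P < ∞ := by
  refine lintegral_sq_add_lt_top measurable_const (by simp) ?_
  have : ∀ s : Finset (Fin K), ∫⁻ ω, (∑ k ∈ s, component α β N k i t ω) ^ 2 ∂P < ∞ := by
    intro s
    induction s using Finset.cons_induction with
    | empty => simp
    | cons k s hk ih =>
      simp_rw [Finset.sum_cons]
      exact lintegral_sq_add_lt_top ((hN.measurable_component k i).comp measurable_prodMk_left)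
        (hS.lintegral_component_sq k i t) ih
  exact this _

theorem lintegral_lt_top_of_sq [IsProbabilityMeasure P] {f : Ω → ℝ≥0∞} (h : ∫⁻ ω, f ω ^ 2 ∂P < ∞) : ∫⁻ ω, f ω ∂P < ∞ := by
  have : ∀ x : ℝ≥0∞, x ≤ 1 + x ^ 2 := fun x => by
    rcases le_total x 1 with hx | hx
    · exact hx.trans le_self_add
    · exact (by simpa [sq] using mul_le_mul_right hx x : x ≤ x ^ 2).trans le_add_self
  refine (lintegral_mono fun ω => this (f ω)).trans_lt ?_
  rw [lintegral_add_left measurable_const]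
  simp [h]

/-- The mean intensity in the steady state, as an extended nonnegative number. -/
def rate (μ : Fin 2 → ℝ) (α : Fin K → Matrix (Fin 2) (Fin 2) ℝ) (β : Fin K → Fin 2 → ℝ)
    (N : Fin 2 → Kernel Ω ℝ) (P : Measure Ω) (i : Fin 2) : ℝ≥0∞ :=
  ∫⁻ ω, intensity μ α β N i 0 ω ∂P

theorem IsSteadyState.lintegral_intensity (hS : IsSteadyState α β N P) (i : Fin 2) (t : ℝ) :
    ∫⁻ ω, intensity μ α β N i t ω ∂P = rate μ α β N P i :=
  hS.lintegral_eq (G := fun x => ENNReal.ofReal (μ i) + ∑ k, x k i) (by fun_prop) t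

theorem IsSteadyState.rate_lt_top [IsProbabilityMeasure P] (hN : IsPointProcess N) (hS : IsSteadyState α β N P) (i : Fin 2) :
    rate μ α β N P i < ∞ :=
  lintegral_lt_top_of_sq (hS.lintegral_intensity_sq hN i 0)

theorem IsHawkes.lintegral_Ioc [IsProbabilityMeasure P] (hN : IsHawkes μ α β N P) (hS : IsSteadyState α β N P)
    (i : Fin 2) (a b : ℝ) :
    ∫⁻ ω, N i ω (Set.Ioc a b) ∂P = rate μ α β N P i * ENNReal.ofReal (b - a) := by
  rcases le_total a b with hab | hab
  · have := hN.hasIntensity i a b hab Set.univ MeasurableSet.univ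
    simp only [Measure.restrict_univ] at this
    rw [this, lintegral_lintegral_swap]
    · simp_rw [hS.lintegral_intensity]
      simp
    · exact (measurable_uncurry_swap (hN.pointProcess.measurable_intensity i)).aemeasurable
  · simp [Set.Ioc_eq_empty_of_le hab, ENNReal.ofReal_of_nonpos (sub_nonpos.2 hab)]

/-- Campbell's formula for the steady-state Hawkes process. -/
theorem IsHawkes.campbell [IsProbabilityMeasure P] (hN : IsHawkes μ α β N P)
    (hS : IsSteadyState α β N P) (i : Fin 2) {g : ℝ → ℝ≥0∞} (hg : Measurable g)
    {H : ℝ → Ω → ℝ≥0∞} (hH : ∀ t, Measurable[history N t] (H t)) (hc : LeftContinuousMono H) :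
    ∫⁻ ω, ∫⁻ u, g u * H u ω ∂(N i ω) ∂P =
      ∫⁻ u, g u * ∫⁻ ω, H u ω * intensity μ α β N i u ω ∂P := by
  refine lintegral_lintegral_mul_eq_of_intensity (F := history N)
    (hN.pointProcess.measurable_intensity i) (history_le N) (fun s t h => history_mono N h)
    (hN.hasIntensity i) (fun a b => ?_) hg hH hc
  rw [hN.lintegral_Ioc hS]
  have := hS.rate_lt_top (μ := μ) hN.pointProcess i
  finiteness

/-- First-order Campbell formula. -/
theorem IsHawkes.lintegral_lintegral [IsProbabilityMeasure P] (hN : IsHawkes μ α β N P) (hS : IsSteadyState α β N P)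
    (i : Fin 2) {g : ℝ → ℝ≥0∞} (hg : Measurable g) :
    ∫⁻ ω, ∫⁻ u, g u ∂(N i ω) ∂P = (∫⁻ u, g u) * rate μ α β N P i := by
  have := hN.campbell hS i hg (H := fun _ _ => 1) (fun _ => measurable_const)
    (LeftContinuousMono.const _)
  simp only [mul_one, one_mul, hS.lintegral_intensity] at this
  rw [this, lintegral_mul_const _ hg]

end Model

end Hawkes

/-! ### Second-order Campbell formula and square integrability of counts -/

namespace Hawkes

/-- A product of two integrals, split according to the order of the two variables. -/
theorem lintegral_mul_lintegral_eq_add (ν₁ ν₂ : Measure ℝ) [SFinite ν₁] [SFinite ν₂]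
    {f h : ℝ → ℝ≥0∞} (hf : Measurable f) (hh : Measurable h) :
    (∫⁻ u, f u ∂ν₁) * ∫⁻ w, h w ∂ν₂ =
      ∫⁻ u, f u * ∫⁻ w in Set.Iio u, h w ∂ν₂ ∂ν₁ + ∫⁻ w, h w * ∫⁻ u in Set.Iio w, f u ∂ν₁ ∂ν₂ +
        ∫⁻ u, f u * h u * ν₂ {u} ∂ν₁ := by
  have hlt : MeasurableSet {p : ℝ × ℝ | p.1 < p.2} := measurableSet_lt measurable_fst measurable_snd
  -- Tonelli on the half-plane u < w lets both ordered parts be compared as integrals over u.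
  have hswap : ∫⁻ w, h w * ∫⁻ u in Set.Iio w, f u ∂ν₁ ∂ν₂ =
      ∫⁻ u, f u * ∫⁻ w in Set.Ioi u, h w ∂ν₂ ∂ν₁ := by
    have e1 : ∀ w, h w * ∫⁻ u in Set.Iio w, f u ∂ν₁ =
        ∫⁻ u, {p : ℝ × ℝ | p.1 < p.2}.indicator (fun p => f p.1 * h p.2) (u, w) ∂ν₁ := fun w => by
      rw [← lintegral_const_mul _ hf, ← lintegral_indicator measurableSet_Iio]
      refine lintegral_congr fun u => ?_
      by_cases hu : u < w <;> simp [hu, mul_comm]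
    have e2 : ∀ u, f u * ∫⁻ w in Set.Ioi u, h w ∂ν₂ =
        ∫⁻ w, {p : ℝ × ℝ | p.1 < p.2}.indicator (fun p => f p.1 * h p.2) (u, w) ∂ν₂ := fun u => by
      rw [← lintegral_const_mul _ hh, ← lintegral_indicator measurableSet_Ioi]
      refine lintegral_congr fun w => ?_
      by_cases hu : u < w <;> simp [hu]
    simp_rw [e1, e2]
    have hm : Measurable ({p : ℝ × ℝ | p.1 < p.2}.indicator (fun p => f p.1 * h p.2)) :=
      ((hf.comp measurable_fst).mul (hh.comp measurable_snd)).indicator hlt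
    exact (lintegral_lintegral_swap (f := fun u w =>
      {p : ℝ × ℝ | p.1 < p.2}.indicator (fun p => f p.1 * h p.2) (u, w)) hm.aemeasurable).symm
  have hsplit : ∀ u, ∫⁻ w, h w ∂ν₂ =
      ∫⁻ w in Set.Iio u, h w ∂ν₂ + ∫⁻ w in Set.Ioi u, h w ∂ν₂ + h u * ν₂ {u} := fun u => by
    rw [← lintegral_add_compl h (measurableSet_Iio (a := u)), Set.compl_Iio, ← Set.Ioi_union_left,
      lintegral_union (measurableSet_singleton u) (by simp), lintegral_singleton, add_assoc]
  have hm1 : Measurable fun u => ∫⁻ w in Set.Iio u, h w ∂ν₂ :=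
    (show Monotone fun u => ∫⁻ w in Set.Iio u, h w ∂ν₂ from
      fun _ _ hab => lintegral_mono_set (Set.Iio_subset_Iio hab)).measurable
  have hm2 : Measurable fun u => ∫⁻ w in Set.Ioi u, h w ∂ν₂ :=
    (show Antitone fun u => ∫⁻ w in Set.Ioi u, h w ∂ν₂ from
      fun _ _ hab => lintegral_mono_set (Set.Ioi_subset_Ioi hab)).measurable
  rw [hswap, ← lintegral_mul_const _ hf, ← lintegral_add_left (by fun_prop),
    ← lintegral_add_left (by fun_prop)]
  refine lintegral_congr fun u => ?_
  conv_lhs => rw [hsplit u]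
  ring

noncomputable section Model

variable {Ω : Type*} [MeasurableSpace Ω] {P : Measure Ω}
  {K : ℕ} {μ : Fin 2 → ℝ} {α : Fin K → Matrix (Fin 2) (Fin 2) ℝ} {β : Fin K → Fin 2 → ℝ}
  {N : Fin 2 → Kernel Ω ℝ}

/-- Simplicity and the absence of common events turn the diagonal of a product of two integrals into
a Kronecker delta. -/
theorem IsPointProcess.ae_singleton (h : IsPointProcess N) (a b : Fin 2) (ω : Ω) :
    ∀ᵐ u ∂(N a ω), N b ω {u} = if a = b then 1 else 0 := by
  filter_upwards [(h.configuration a ω).ae_singleton] with u hu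
  have hc := h.no_common_events ω u
  split_ifs with hab
  · rw [← hab, hu]
  · fin_cases a <;> fin_cases b <;> simp_all

theorem IsPointProcess.lintegral_mul_lintegral (hN : IsPointProcess N) (a b : Fin 2) (ω : Ω)
    {f h : ℝ → ℝ≥0∞} (hf : Measurable f) (hh : Measurable h) :
    (∫⁻ u, f u ∂(N a ω)) * ∫⁻ w, h w ∂(N b ω) =
      ∫⁻ u, f u * ∫⁻ w in Set.Iio u, h w ∂(N b ω) ∂(N a ω) +
      ∫⁻ w, h w * ∫⁻ u in Set.Iio w, f u ∂(N a ω) ∂(N b ω) +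
        if a = b then ∫⁻ u, f u * h u ∂(N a ω) else 0 := by
  have := hN.isSFiniteKernel a
  have := hN.isSFiniteKernel b
  rw [lintegral_mul_lintegral_eq_add _ _ hf hh]
  congr 1
  have e : ∫⁻ u, f u * h u * N b ω {u} ∂(N a ω) =
      ∫⁻ u, f u * h u * (if a = b then 1 else 0) ∂(N a ω) := by
    refine lintegral_congr_ae ?_
    filter_upwards [hN.ae_singleton a b ω] with u hu
    rw [hu]
  rw [e]
  split_ifs <;> simp

theorem IsPointProcess.measurable_lintegral_Iio (hN : IsPointProcess N) (a : Fin 2)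
    {h : ℝ → ℝ≥0∞} (hh : Measurable h) :
    Measurable fun p : ℝ × Ω => ∫⁻ w in Set.Iio p.1, h w ∂(N a p.2) :=
  (LeftContinuousMono.setLIntegral_Iio (fun ω => N a ω) h).measurable_uncurry fun t =>
    (hN.measurable_history_setLIntegral_Iio a t hh).mono (history_le N t) le_rfl

/-- Second-order moments of integrals against the process. -/
theorem IsHawkes.lintegral_mul [IsProbabilityMeasure P] (hN : IsHawkes μ α β N P)
    (hS : IsSteadyState α β N P) (a b : Fin 2) {f h : ℝ → ℝ≥0∞} (hf : Measurable f)
    (hh : Measurable h) :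
    ∫⁻ ω, (∫⁻ u, f u ∂(N a ω)) * (∫⁻ w, h w ∂(N b ω)) ∂P =
      (∫⁻ u, f u * ∫⁻ ω, (∫⁻ w in Set.Iio u, h w ∂(N b ω)) * intensity μ α β N a u ω ∂P) +
      (∫⁻ w, h w * ∫⁻ ω, (∫⁻ u in Set.Iio w, f u ∂(N a ω)) * intensity μ α β N b w ω ∂P) +
        if a = b then (∫⁻ u, f u * h u) * rate μ α β N P a else 0 := by
  have hpp := hN.pointProcess
  have hmeas : ∀ (a b : Fin 2) {f h : ℝ → ℝ≥0∞}, Measurable f → Measurable h →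
      Measurable fun ω => ∫⁻ u, f u * ∫⁻ w in Set.Iio u, h w ∂(N b ω) ∂(N a ω) := by
    intro a b f h hf hh
    have := hpp.isSFiniteKernel a
    have h1 := hpp.measurable_lintegral_Iio b hh
    refine Measurable.lintegral_kernel_prod_right ?_
    refine measurable_uncurry_swap (f := fun u ω => f u * ∫⁻ w in Set.Iio u, h w ∂(N b ω)) ?_
    fun_prop
  simp_rw [fun ω => hpp.lintegral_mul_lintegral a b ω hf hh]
  have hm2 : Measurable fun ω => ∫⁻ u, f u * ∫⁻ w in Set.Iio u, h w ∂(N b ω) ∂(N a ω) +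
      ∫⁻ w, h w * ∫⁻ u in Set.Iio w, f u ∂(N a ω) ∂(N b ω) :=
    (hmeas a b hf hh).add (hmeas b a hh hf)
  rw [lintegral_add_left hm2, lintegral_add_left (hmeas a b hf hh),
    hN.campbell hS a hf (fun t => hpp.measurable_history_setLIntegral_Iio b t hh)
      (LeftContinuousMono.setLIntegral_Iio _ _),
    hN.campbell hS b hh (fun t => hpp.measurable_history_setLIntegral_Iio a t hf)
      (LeftContinuousMono.setLIntegral_Iio _ _)]
  congr 1
  split_ifs
  · rw [hN.lintegral_lintegral hS a (g := fun u => f u * h u) (hf.mul hh)]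
  · simp

/-- Number of pairs of events, with truncation: the elementary inequality behind the second
moment bound. -/
theorem IsPointProcess.min_sq_le (hN : IsPointProcess N) (a : Fin 2) (t : ℝ) (c : ℝ≥0∞) (ω : Ω) :
    min (N a ω (Set.Ioc 0 t)) c ^ 2 ≤
      2 * ∫⁻ u, (Set.Ioc 0 t).indicator 1 u * min (N a ω (Set.Ioo 0 u)) c ∂(N a ω) +
        N a ω (Set.Ioc 0 t) := by
  have hi : Measurable ((Set.Ioc 0 t).indicator (1 : ℝ → ℝ≥0∞)) :=
    measurable_one.indicator measurableSet_Ioc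
  set n := N a ω (Set.Ioc 0 t) with hn
  have hnt : n < ∞ := (hN.configuration a ω).measure_Ioc_lt_top 0 t
  have hpast : ∀ u, (Set.Ioc 0 t).indicator (1 : ℝ → ℝ≥0∞) u *
      ∫⁻ w in Set.Iio u, (Set.Ioc 0 t).indicator 1 w ∂(N a ω) =
      (Set.Ioc 0 t).indicator 1 u * N a ω (Set.Ioo 0 u) := fun u => by
    by_cases hu : u ∈ Set.Ioc 0 t
    · congr 1
      rw [lintegral_indicator_one measurableSet_Ioc, Measure.restrict_apply measurableSet_Ioc]
      congr 1
      ext w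
      simp only [Set.mem_inter_iff, Set.mem_Ioc, Set.mem_Iio, Set.mem_Ioo]
      exact ⟨fun h => ⟨h.1.1, h.2⟩, fun h => ⟨⟨h.1, (h.2.trans_le hu.2).le⟩, h.2⟩⟩
    · simp [hu]
  have hle : ∀ u ∈ Set.Ioc 0 t, N a ω (Set.Ioo 0 u) ≤ n := fun u hu =>
    measure_mono fun w hw => ⟨hw.1, hw.2.le.trans hu.2⟩
  -- Without truncation there is equality: ordered pairs of events are twice the pairs with a strict
  -- order, plus the diagonal.
  have hsq : n ^ 2 = 2 * ∫⁻ u, (Set.Ioc 0 t).indicator 1 u * N a ω (Set.Ioo 0 u) ∂(N a ω) + n := by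
    have := hN.lintegral_mul_lintegral a a ω hi hi
    simp_rw [hpast, lintegral_indicator_one measurableSet_Ioc, if_true] at this
    rw [sq, hn, this, two_mul]
    congr 1
    rw [← lintegral_indicator_one measurableSet_Ioc]
    refine lintegral_congr fun u => ?_
    by_cases hu : u ∈ Set.Ioc 0 t <;> simp [hu]
  rcases le_or_gt n c with hc | hc
  · rw [min_eq_left hc, hsq]
    gcongr 2 * ?_ + _
    refine lintegral_mono fun u => ?_
    by_cases hu : u ∈ Set.Ioc 0 t
    · rw [min_eq_left ((hle u hu).trans hc)]
    · simp [Set.indicator_of_notMem hu]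
  · rw [min_eq_right hc.le]
    have hn0 : n ≠ 0 := (bot_le.trans_lt hc).ne'
    -- If n > c, each earlier count x ≤ n satisfies c x ≤ n min(x, c). Multiplying the exact
    -- identity by c and inserting this bound leaves a factor n to cancel; finally c² ≤ c n.
    have key : n * (c * n) ≤ n * (2 * ∫⁻ u, (Set.Ioc 0 t).indicator 1 u *
        min (N a ω (Set.Ioo 0 u)) c ∂(N a ω) + n) := by
      have h1 : c * ∫⁻ u, (Set.Ioc 0 t).indicator 1 u * N a ω (Set.Ioo 0 u) ∂(N a ω) ≤
          n * ∫⁻ u, (Set.Ioc 0 t).indicator 1 u * min (N a ω (Set.Ioo 0 u)) c ∂(N a ω) := by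
        rw [← lintegral_const_mul' _ _ hc.ne_top, ← lintegral_const_mul' _ _ hnt.ne]
        refine lintegral_mono fun u => ?_
        by_cases hu : u ∈ Set.Ioc 0 t
        · simp only [Set.indicator_of_mem hu, Pi.one_apply, one_mul]
          rcases le_total (N a ω (Set.Ioo 0 u)) c with h | h
          · rw [min_eq_left h]
            exact mul_le_mul_left hc.le _
          · rw [min_eq_right h, mul_comm n]
            exact mul_le_mul_right (hle u hu) _
        · simp [Set.indicator_of_notMem hu]
      calc n * (c * n) = c * n ^ 2 := by ring
        _ = 2 * (c * ∫⁻ u, (Set.Ioc 0 t).indicator 1 u * N a ω (Set.Ioo 0 u) ∂(N a ω)) + c * n := by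
          conv_lhs => rw [hsq]
          ring
        _ ≤ 2 * (n * ∫⁻ u, (Set.Ioc 0 t).indicator 1 u * min (N a ω (Set.Ioo 0 u)) c ∂(N a ω)) +
            n * n := by gcongr
        _ = _ := by ring
    calc c ^ 2 = c * c := sq c
      _ ≤ c * n := by gcongr
      _ ≤ _ := (ENNReal.mul_le_mul_iff_right hn0 hnt.ne).1 key

/-- Young's inequality with a free weight and without the optimal constant. A small δ is used for
absorption, δ = 1 for integrability of products. -/
theorem mul_le_sq_add_sq (x y : ℝ≥0∞) {δ : ℝ≥0∞} (h0 : δ ≠ 0) (ht : δ ≠ ∞) :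
    x * y ≤ δ * x ^ 2 + δ⁻¹ * y ^ 2 := by
  rcases le_total y (δ * x) with h | h
  · calc x * y ≤ x * (δ * x) := by gcongr
      _ = δ * x ^ 2 := by ring
      _ ≤ _ := le_self_add
  · have hx : x ≤ δ⁻¹ * y := by
      rw [mul_comm, ← div_eq_mul_inv, ENNReal.le_div_iff_mul_le (.inl h0) (.inl ht), mul_comm]
      exact h
    calc x * y ≤ (δ⁻¹ * y) * y := by gcongr
      _ = δ⁻¹ * y ^ 2 := by ring
      _ ≤ _ := le_add_self

theorem IsSteadyState.lintegral_intensity_sq_eq (hS : IsSteadyState α β N P) (i : Fin 2) (t : ℝ) :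
    ∫⁻ ω, intensity μ α β N i t ω ^ 2 ∂P = ∫⁻ ω, intensity μ α β N i 0 ω ^ 2 ∂P :=
  hS.lintegral_eq (G := fun x => (ENNReal.ofReal (μ i) + ∑ k, x k i) ^ 2) (by fun_prop) t

/-- The counts have finite second moments. -/
theorem IsHawkes.lintegral_count_sq [IsProbabilityMeasure P] (hN : IsHawkes μ α β N P)
    (hS : IsSteadyState α β N P) (a : Fin 2) {t : ℝ} (ht : 0 < t) :
    ∫⁻ ω, N a ω (Set.Ioc 0 t) ^ 2 ∂P < ∞ := by
  have hpp := hN.pointProcess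
  set L := ∫⁻ ω, intensity μ α β N a 0 ω ^ 2 ∂P with hL
  have hLt : L < ∞ := hS.lintegral_intensity_sq hpp a 0
  have hmn : Measurable fun ω => N a ω (Set.Ioc 0 t) := (N a).measurable_coe measurableSet_Ioc
  have hr := hS.rate_lt_top (μ := μ) hpp a
  set T := ENNReal.ofReal t with hT
  have hT0 : T ≠ 0 := by simpa [hT] using ht
  have hTt : T ≠ ∞ := ENNReal.ofReal_ne_top
  -- Chosen so that 2 δ g T = g / 2 below, which can be absorbed into the left-hand side.
  set δ : ℝ≥0∞ := (4 * T)⁻¹ with hδ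
  have hδ0 : δ ≠ 0 := ENNReal.inv_ne_zero.2 (by finiteness)
  have hδt : δ ≠ ∞ := by simp [hδ, hT0]
  set B : ℝ≥0∞ := 2 * (2 * (δ⁻¹ * L * T) + rate μ α β N P a * T) with hB
  have hBt : B < ∞ := by
    have : δ⁻¹ ≠ ∞ := by simpa using hδ0
    finiteness
  -- Truncation makes g finite, so g ≤ g/2 + B/2 may be solved for g. The resulting B does not
  -- depend on c, and monotone convergence removes the truncation.
  have bound : ∀ c : ℕ, ∫⁻ ω, min (N a ω (Set.Ioc 0 t)) c ^ 2 ∂P ≤ B := fun c => by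
    set g := ∫⁻ ω, min (N a ω (Set.Ioc 0 t)) c ^ 2 ∂P with hg
    have hgt : g < ∞ := by
      calc g ≤ ∫⁻ _, (c : ℝ≥0∞) ^ 2 ∂P := lintegral_mono fun ω => by gcongr; exact min_le_right _ _
        _ < ∞ := by simp
    have h1 : ∫⁻ ω, ∫⁻ u, (Set.Ioc 0 t).indicator 1 u * min (N a ω (Set.Ioo 0 u)) c ∂(N a ω) ∂P ≤
        (δ * g + δ⁻¹ * L) * T := by
      rw [hN.campbell hS a (measurable_one.indicator measurableSet_Ioc)
        (fun t => (hpp.measurable_history_Ioo a t).min measurable_const)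
        ((leftContinuousMono_Ioo a).inf_const c)]
      have : (δ * g + δ⁻¹ * L) * T = ∫⁻ u, (Set.Ioc 0 t).indicator (fun _ => δ * g + δ⁻¹ * L) u := by
        rw [lintegral_indicator_const measurableSet_Ioc, Real.volume_Ioc, sub_zero]
      rw [this]
      refine lintegral_mono fun u => ?_
      by_cases hu : u ∈ Set.Ioc 0 t
      · simp only [hu, Set.indicator_of_mem, Pi.one_apply, one_mul]
        calc ∫⁻ ω, min (N a ω (Set.Ioo 0 u)) c * intensity μ α β N a u ω ∂P
            ≤ ∫⁻ ω, (δ * min (N a ω (Set.Ioc 0 t)) c ^ 2 + δ⁻¹ * intensity μ α β N a u ω ^ 2) ∂P := by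
              refine lintegral_mono fun ω => ?_
              refine le_trans ?_ (mul_le_sq_add_sq _ _ hδ0 hδt)
              gcongr
              exact fun w hw => ⟨hw.1, hw.2.le.trans hu.2⟩
          _ = δ * g + δ⁻¹ * L := by
              rw [lintegral_add_left (by fun_prop), lintegral_const_mul _ (by fun_prop),
                lintegral_const_mul' _ _ (by simpa using hδ0), hS.lintegral_intensity_sq_eq]
      · simp [hu]
    have h2 : g ≤ 2 * ((δ * g + δ⁻¹ * L) * T) + rate μ α β N P a * T := by
      calc g ≤ ∫⁻ ω, (2 * ∫⁻ u, (Set.Ioc 0 t).indicator 1 u * min (N a ω (Set.Ioo 0 u)) c ∂(N a ω) +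
            N a ω (Set.Ioc 0 t)) ∂P := lintegral_mono fun ω => hpp.min_sq_le a t c ω
        _ = 2 * ∫⁻ ω, ∫⁻ u, (Set.Ioc 0 t).indicator 1 u * min (N a ω (Set.Ioo 0 u)) c ∂(N a ω) ∂P +
            rate μ α β N P a * T := by
          rw [lintegral_add_right _ hmn, lintegral_const_mul' _ _ (by finiteness),
            hN.lintegral_Ioc hS, sub_zero]
        _ ≤ _ := by gcongr
    have h3 : 2 * (δ * g * T) = g / 2 := by
      have : 2 * (δ * g * T) = g * (2 * (δ * T)) := by ring
      rw [this, hδ, ENNReal.mul_inv (.inl (by norm_num)) (.inl (by norm_num)), mul_assoc,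
        ENNReal.inv_mul_cancel hT0 hTt, mul_one, div_eq_mul_inv]
      congr 1
      rw [show (4 : ℝ≥0∞) = 2 * 2 by norm_num, ENNReal.mul_inv (.inl (by norm_num)) (.inl (by norm_num)),
        ← mul_assoc, ENNReal.mul_inv_cancel (by norm_num) (by norm_num), one_mul]
    have h4 : g / 2 + g / 2 ≤ g / 2 + (2 * (δ⁻¹ * L * T) + rate μ α β N P a * T) := by
      rw [ENNReal.add_halves]
      calc g ≤ _ := h2
        _ = 2 * (δ * g * T) + (2 * (δ⁻¹ * L * T) + rate μ α β N P a * T) := by ring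
        _ = _ := by rw [h3]
    have h5 := (ENNReal.add_le_add_iff_left (by finiteness)).1 h4
    calc g = 2 * (g / 2) := by rw [two_mul, ENNReal.add_halves]
      _ ≤ B := by rw [hB]; gcongr
  have hsup : ∀ ω, ⨆ c : ℕ, min (N a ω (Set.Ioc 0 t)) c ^ 2 = N a ω (Set.Ioc 0 t) ^ 2 := fun ω => by
    refine le_antisymm (iSup_le fun c => by gcongr; exact min_le_left _ _) ?_
    obtain ⟨c, hc⟩ := ENNReal.exists_nat_gt ((hpp.configuration a ω).measure_Ioc_lt_top 0 t).ne
    exact le_iSup_of_le c (by rw [min_eq_left hc.le])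
  refine lt_of_le_of_lt ?_ hBt
  simp_rw [← hsup]
  rw [lintegral_iSup (fun c => by fun_prop) fun c d hcd ω => by
    dsimp only
    gcongr]
  exact iSup_le bound

end Model

end Hawkes

/-! ### Integral equations for mixed moments of counts and intensities -/

namespace Hawkes

noncomputable section Model

variable {Ω : Type*} [MeasurableSpace Ω] {P : Measure Ω}
  {K : ℕ} {μ : Fin 2 → ℝ} {α : Fin K → Matrix (Fin 2) (Fin 2) ℝ} {β : Fin K → Fin 2 → ℝ}
  {N : Fin 2 → Kernel Ω ℝ}

/-- `E[N_a(0, t) λ_j(t)]`. -/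
def countIntensity (μ : Fin 2 → ℝ) (α : Fin K → Matrix (Fin 2) (Fin 2) ℝ) (β : Fin K → Fin 2 → ℝ)
    (N : Fin 2 → Kernel Ω ℝ) (P : Measure Ω) (a j : Fin 2) (t : ℝ) : ℝ≥0∞ :=
  ∫⁻ ω, N a ω (Set.Ioo 0 t) * intensity μ α β N j t ω ∂P

/-- `E[N_a(0, t) λ_{ki}(t)]`. -/
def countComponent (α : Fin K → Matrix (Fin 2) (Fin 2) ℝ) (β : Fin K → Fin 2 → ℝ)
    (N : Fin 2 → Kernel Ω ℝ) (P : Measure Ω) (a : Fin 2) (k : Fin K) (i : Fin 2) (t : ℝ) : ℝ≥0∞ :=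
  ∫⁻ ω, N a ω (Set.Ioo 0 t) * component α β N k i t ω ∂P

/-- `E[λ_{ki}(t) λ_a(t)]` in the steady state. -/
def componentIntensity (μ : Fin 2 → ℝ) (α : Fin K → Matrix (Fin 2) (Fin 2) ℝ)
    (β : Fin K → Fin 2 → ℝ) (N : Fin 2 → Kernel Ω ℝ) (P : Measure Ω) (k : Fin K) (i a : Fin 2) :
    ℝ≥0∞ :=
  ∫⁻ ω, component α β N k i 0 ω * intensity μ α β N a 0 ω ∂P

theorem IsSteadyState.lintegral_component_mul_intensity (hS : IsSteadyState α β N P) (k : Fin K)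
    (i a : Fin 2) (t : ℝ) : ∫⁻ ω, component α β N k i t ω * intensity μ α β N a t ω ∂P =
      componentIntensity μ α β N P k i a :=
  hS.lintegral_eq (G := fun x => x k i * (ENNReal.ofReal (μ a) + ∑ l, x l a)) (by fun_prop) t

theorem lintegral_mul_lt_top_of_sq {f g : Ω → ℝ≥0∞} (hf : Measurable f)
    (h1 : ∫⁻ ω, f ω ^ 2 ∂P < ∞) (h2 : ∫⁻ ω, g ω ^ 2 ∂P < ∞) : ∫⁻ ω, f ω * g ω ∂P < ∞ := by
  refine (lintegral_mono fun ω => mul_le_sq_add_sq (f ω) (g ω) one_ne_zero ENNReal.one_ne_top).trans_lt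
    ?_
  rw [lintegral_add_left (by fun_prop)]
  simp [h1, h2]

theorem IsSteadyState.componentIntensity_lt_top [IsProbabilityMeasure P]
    (hN : IsPointProcess N) (hS : IsSteadyState α β N P)
    (k : Fin K) (i a : Fin 2) : componentIntensity μ α β N P k i a < ∞ :=
  lintegral_mul_lt_top_of_sq ((hN.measurable_component k i).comp measurable_prodMk_left)
    (hS.lintegral_component_sq k i 0) (hS.lintegral_intensity_sq hN a 0)

theorem IsHawkes.lintegral_Ioo [IsProbabilityMeasure P] (hN : IsHawkes μ α β N P)
    (hS : IsSteadyState α β N P) (a : Fin 2) (t : ℝ) :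
    ∫⁻ ω, N a ω (Set.Ioo 0 t) ∂P = rate μ α β N P a * ENNReal.ofReal t := by
  have := hN.lintegral_lintegral hS a (g := (Set.Ioo 0 t).indicator 1)
    (measurable_one.indicator measurableSet_Ioo)
  simp_rw [lintegral_indicator_one measurableSet_Ioo] at this
  rw [this, Real.volume_Ioo, sub_zero, mul_comm]

/-- One half of the closed system: the base rate contributes the linear term through the mean count,
and the rest is linear in the component moments. -/
theorem IsHawkes.countIntensity_eq [IsProbabilityMeasure P] (hN : IsHawkes μ α β N P)
    (hS : IsSteadyState α β N P) (a j : Fin 2) (t : ℝ) :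
    countIntensity μ α β N P a j t = ENNReal.ofReal (μ j) * (rate μ α β N P a * ENNReal.ofReal t) +
      ∑ k, countComponent α β N P a k j t := by
  have hm : Measurable fun ω => N a ω (Set.Ioo 0 t) := (N a).measurable_coe measurableSet_Ioo
  have hc : ∀ k, Measurable fun ω => component α β N k j t ω := fun k =>
    (hN.pointProcess.measurable_component k j).comp measurable_prodMk_left
  have hmc : ∀ k, Measurable fun ω => N a ω (Set.Ioo 0 t) * component α β N k j t ω :=
    fun k => hm.mul (hc k)
  simp only [countIntensity, countComponent, intensity, mul_add, Finset.mul_sum]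
  rw [lintegral_add_left (by fun_prop), lintegral_finsetSum _ fun k _ => hmc k,
    lintegral_mul_const _ hm, hN.lintegral_Ioo hS, mul_comm]

theorem IsPointProcess.measurable_countIntensity [IsProbabilityMeasure P] (hN : IsPointProcess N)
    (a j : Fin 2) : Measurable (countIntensity μ α β N P a j) := by
  have h1 : Measurable fun p : ℝ × Ω => N a p.2 (Set.Ioo 0 p.1) :=
    (leftContinuousMono_Ioo a).measurable_uncurry fun t => (N a).measurable_coe measurableSet_Ioo
  have h2 : Measurable fun p : ℝ × Ω => N a p.2 (Set.Ioo 0 p.1) * intensity μ α β N j p.1 p.2 :=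
    h1.mul (hN.measurable_intensity j)
  exact h2.lintegral_prod_right'

/-- The mixed moments are bounded on bounded time intervals. -/
theorem IsHawkes.exists_countIntensity_le [IsProbabilityMeasure P] (hN : IsHawkes μ α β N P)
    (hS : IsSteadyState α β N P) (a j : Fin 2) {T : ℝ} (hT : 0 < T) :
    ∃ B < ∞, ∀ t ≤ T, countIntensity μ α β N P a j t ≤ B := by
  refine ⟨∫⁻ ω, N a ω (Set.Ioc 0 T) ^ 2 ∂P + ∫⁻ ω, intensity μ α β N j 0 ω ^ 2 ∂P,
    ENNReal.add_lt_top.2 ⟨hN.lintegral_count_sq hS a hT,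
      hS.lintegral_intensity_sq hN.pointProcess j 0⟩, fun t ht => ?_⟩
  have hm : Measurable fun ω => N a ω (Set.Ioc 0 T) := (N a).measurable_coe measurableSet_Ioc
  rw [← hS.lintegral_intensity_sq_eq j t, ← lintegral_add_left (by fun_prop)]
  refine lintegral_mono fun ω => ?_
  calc N a ω (Set.Ioo 0 t) * intensity μ α β N j t ω
      ≤ N a ω (Set.Ioc 0 T) * intensity μ α β N j t ω := by
        gcongr
        exact fun w hw => ⟨hw.1, hw.2.le.trans ht⟩
    _ ≤ _ := by
      simpa using mul_le_sq_add_sq (N a ω (Set.Ioc 0 T)) (intensity μ α β N j t ω) one_ne_zero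
        ENNReal.one_ne_top

theorem setLIntegral_Iio_indicator_Ioo (ν : Measure ℝ) {t w : ℝ} (h : w ≤ t) :
    ∫⁻ u in Set.Iio w, (Set.Ioo 0 t).indicator 1 u ∂ν = ν (Set.Ioo 0 w) := by
  rw [lintegral_indicator_one measurableSet_Ioo, Measure.restrict_apply measurableSet_Ioo,
    Set.Ioo_inter_Iio, min_eq_right h]

/-- Mean of the product of a count and an integral over the past. -/
theorem IsHawkes.lintegral_Ioo_mul_setLIntegral_Iio [IsProbabilityMeasure P]
    (hN : IsHawkes μ α β N P) (hS : IsSteadyState α β N P) (a j : Fin 2) {f : ℝ → ℝ≥0∞}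
    (hf : Measurable f) (t : ℝ) :
    ∫⁻ ω, (∫⁻ u, (Set.Ioo 0 t).indicator 1 u ∂(N a ω)) *
        (∫⁻ w, (Set.Iio t).indicator f w ∂(N j ω)) ∂P =
      (∫⁻ u in Set.Ioo 0 t, ∫⁻ ω, (∫⁻ w in Set.Iio u, f w ∂(N j ω)) *
          intensity μ α β N a u ω ∂P) +
        (∫⁻ u in Set.Ioo 0 t, f u * countIntensity μ α β N P a j u) +
        if a = j then (∫⁻ u in Set.Ioo 0 t, f u) * rate μ α β N P a else 0 := by
  rw [hN.lintegral_mul hS a j (measurable_one.indicator measurableSet_Ioo)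
    (hf.indicator measurableSet_Iio)]
  congr 1
  · congr 1
    · rw [← lintegral_indicator measurableSet_Ioo]
      refine lintegral_congr fun u => ?_
      by_cases hu : u ∈ Set.Ioo 0 t
      · simp only [Set.indicator_of_mem hu, Pi.one_apply, one_mul]
        refine lintegral_congr fun ω => ?_
        rw [setLIntegral_indicator measurableSet_Iio, Set.inter_eq_right.2
          (Set.Iio_subset_Iio hu.2.le)]
      · simp [Set.indicator_of_notMem hu]
    · rw [← lintegral_indicator measurableSet_Ioo]
      refine lintegral_congr fun u => ?_
      by_cases hu : u < t
      · rw [Set.indicator_of_mem (show u ∈ Set.Iio t from hu)]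
        simp_rw [setLIntegral_Iio_indicator_Ioo _ hu.le]
        by_cases hu0 : 0 < u
        · rw [Set.indicator_of_mem (show u ∈ Set.Ioo 0 t from ⟨hu0, hu⟩), countIntensity]
        · rw [Set.indicator_of_notMem (fun h => hu0 h.1), Set.Ioo_eq_empty (fun h => hu0 h)]
          simp
      · rw [Set.indicator_of_notMem (show u ∉ Set.Iio t from hu),
          Set.indicator_of_notMem (fun h => hu h.2), zero_mul]
  · congr 2
    rw [← lintegral_indicator measurableSet_Ioo]
    refine lintegral_congr fun u => ?_
    by_cases hu : u ∈ Set.Ioo 0 t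
    · rw [Set.indicator_of_mem hu, Set.indicator_of_mem hu,
        Set.indicator_of_mem (show u ∈ Set.Iio t from hu.2), Pi.one_apply, one_mul]
    · simp [Set.indicator_of_notMem hu]

theorem IsPointProcess.measurable_lintegral_mul_intensity [IsProbabilityMeasure P]
    (hN : IsPointProcess N) (a j : Fin 2) {f : ℝ → ℝ≥0∞} (hf : Measurable f) :
    Measurable fun u => ∫⁻ ω, (∫⁻ w in Set.Iio u, f w ∂(N j ω)) * intensity μ α β N a u ω ∂P := by
  have h : Measurable fun p : ℝ × Ω =>
      (∫⁻ w in Set.Iio p.1, f w ∂(N j p.2)) * intensity μ α β N a p.1 p.2 :=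
    (hN.measurable_lintegral_Iio j hf).mul (hN.measurable_intensity a)
  exact h.lintegral_prod_right'

/-- Integral equation for `E[N_a(0, t) λ_{ki}(t)]`. -/
theorem IsHawkes.countComponent_eq [IsProbabilityMeasure P] (hN : IsHawkes μ α β N P)
    (hS : IsSteadyState α β N P) (a : Fin 2) (k : Fin K) (i : Fin 2) (t : ℝ) :
    ENNReal.ofReal (Real.exp (β k i * t)) * countComponent α β N P a k i t =
      ∫⁻ u in Set.Ioo 0 t, ENNReal.ofReal (Real.exp (β k i * u)) *
        (componentIntensity μ α β N P k i a + ENNReal.ofReal (α k i a) * rate μ α β N P a +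
          ∑ j, ENNReal.ofReal (α k i j) * countIntensity μ α β N P a j u) := by
  have hpp := hN.pointProcess
  have hw : ∀ j, Measurable (weight α β k i j) := fun j => measurable_weight k i j
  have hwe : ∀ j u, weight α β k i j u =
      ENNReal.ofReal (Real.exp (β k i * u)) * ENNReal.ofReal (α k i j) := fun j u => by
    rw [weight, mul_comm, ENNReal.ofReal_mul (Real.exp_pos _).le]
  have hX := fun j => hpp.measurable_countIntensity (P := P) (μ := μ) (α := α) (β := β) a j
  have hmIio : ∀ j u, Measurable fun ω => ∫⁻ w in Set.Iio u, weight α β k i j w ∂(N j ω) :=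
    fun j u => (hpp.measurable_lintegral_Iio j (hw j)).comp measurable_prodMk_left
  have hint : ∀ u, Measurable fun ω => intensity μ α β N a u ω := fun u =>
    hpp.measurable_intensity_apply a u
  -- The factor e^{βt} replaces the component by its accumulated form, a sum of integrals with
  -- weights that do not depend on t.
  have hLHS : ENNReal.ofReal (Real.exp (β k i * t)) * countComponent α β N P a k i t =
      ∑ j, ∫⁻ ω, (∫⁻ u, (Set.Ioo 0 t).indicator 1 u ∂(N a ω)) *
        (∫⁻ w, (Set.Iio t).indicator (weight α β k i j) w ∂(N j ω)) ∂P := by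
    rw [countComponent, ← lintegral_const_mul' _ _ (by finiteness), ← lintegral_finsetSum]
    · refine lintegral_congr fun ω => ?_
      rw [mul_left_comm, ← accumulated_eq, accumulated, Finset.mul_sum]
      refine Finset.sum_congr rfl fun j _ => ?_
      rw [lintegral_indicator_one measurableSet_Ioo, lintegral_indicator measurableSet_Iio]
    · intro j _
      simp_rw [lintegral_indicator_one measurableSet_Ioo, lintegral_indicator measurableSet_Iio]
      exact ((N a).measurable_coe measurableSet_Ioo).mul (hmIio j t)
  have h1 := fun j => hN.lintegral_Ioo_mul_setLIntegral_Iio hS a j (hw j) t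
  -- When the counted event comes last, at u, the sum over j rebuilds the component at u;
  -- stationarity makes its moment with λ_a(u) a constant.
  have h2 : ∀ u, ∑ j, ∫⁻ ω, (∫⁻ w in Set.Iio u, weight α β k i j w ∂(N j ω)) *
      intensity μ α β N a u ω ∂P =
        ENNReal.ofReal (Real.exp (β k i * u)) * componentIntensity μ α β N P k i a := fun u => by
    have hm : ∀ j, Measurable fun ω => (∫⁻ w in Set.Iio u, weight α β k i j w ∂(N j ω)) *
      intensity μ α β N a u ω := fun j => (hmIio j u).mul (hint u)
    rw [← lintegral_finsetSum _ fun j _ => hm j,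
      ← hS.lintegral_component_mul_intensity k i a u, ← lintegral_const_mul' _ _ (by finiteness)]
    refine lintegral_congr fun ω => ?_
    rw [← Finset.sum_mul, ← mul_assoc, ← accumulated_eq, accumulated]
  have hm2 := fun j =>
    hpp.measurable_lintegral_mul_intensity (P := P) (μ := μ) (α := α) (β := β) a j (hw j)
  have hm3 : ∀ j, Measurable fun u => weight α β k i j u * countIntensity μ α β N P a j u :=
    fun j => (hw j).mul (hX j)
  rw [hLHS]
  simp_rw [h1]
  rw [Finset.sum_add_distrib, Finset.sum_add_distrib, ← lintegral_finsetSum _ fun j _ => hm2 j,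
    ← lintegral_finsetSum _ fun j _ => hm3 j, Finset.sum_ite_eq Finset.univ a,
    if_pos (Finset.mem_univ _), ← lintegral_mul_const _ (hw a)]
  simp_rw [h2]
  rw [← lintegral_add_left (by fun_prop), ← lintegral_add_right _ (by fun_prop)]
  refine lintegral_congr fun u => ?_
  simp_rw [hwe, mul_assoc]
  rw [← Finset.mul_sum]
  ring

/-- Second moments of the counts. -/
theorem IsHawkes.lintegral_count_mul [IsProbabilityMeasure P] (hN : IsHawkes μ α β N P)
    (hS : IsSteadyState α β N P) (a b : Fin 2) (t : ℝ) :
    ∫⁻ ω, N a ω (Set.Ioc 0 t) * N b ω (Set.Ioc 0 t) ∂P =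
      (∫⁻ u in Set.Ioc 0 t, countIntensity μ α β N P b a u) +
      (∫⁻ u in Set.Ioc 0 t, countIntensity μ α β N P a b u) +
        if a = b then ENNReal.ofReal t * rate μ α β N P a else 0 := by
  have hi : Measurable ((Set.Ioc 0 t).indicator (1 : ℝ → ℝ≥0∞)) :=
    measurable_one.indicator measurableSet_Ioc
  have := hN.lintegral_mul hS a b hi hi
  simp_rw [lintegral_indicator_one measurableSet_Ioc] at this
  rw [this]
  have key : ∀ a b : Fin 2, ∫⁻ u, (Set.Ioc 0 t).indicator 1 u * ∫⁻ ω,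
      (N b ω).restrict (Set.Iio u) (Set.Ioc 0 t) * intensity μ α β N a u ω ∂P =
      ∫⁻ u in Set.Ioc 0 t, countIntensity μ α β N P b a u := fun a b => by
    rw [← lintegral_indicator measurableSet_Ioc]
    refine lintegral_congr fun u => ?_
    by_cases hu : u ∈ Set.Ioc 0 t
    · rw [Set.indicator_of_mem hu, Set.indicator_of_mem hu, Pi.one_apply, one_mul, countIntensity]
      refine lintegral_congr fun ω => ?_
      rw [Measure.restrict_apply measurableSet_Ioc]
      congr 2
      ext w
      simp only [Set.mem_inter_iff, Set.mem_Ioc, Set.mem_Iio, Set.mem_Ioo]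
      exact ⟨fun h => ⟨h.1.1, h.2⟩, fun h => ⟨⟨h.1, (h.2.trans_le hu.2).le⟩, h.2⟩⟩
    · simp [Set.indicator_of_notMem hu]
  rw [key a b, key b a]
  congr 3
  have : ∀ u, (Set.Ioc 0 t).indicator (1 : ℝ → ℝ≥0∞) u * (Set.Ioc 0 t).indicator 1 u =
      (Set.Ioc 0 t).indicator 1 u := fun u => by
    by_cases hu : u ∈ Set.Ioc 0 t
    · simp [Set.indicator_of_mem hu]
    · simp [Set.indicator_of_notMem hu]
  simp_rw [this]
  rw [lintegral_indicator_one measurableSet_Ioc, Real.volume_Ioc, sub_zero]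

/-- The stationary mean of an intensity component. -/
theorem IsHawkes.lintegral_component [IsProbabilityMeasure P] (hN : IsHawkes μ α β N P)
    (hS : IsSteadyState α β N P) (hα : ∀ k i j, 0 ≤ α k i j) (hβ : ∀ k i, 0 < β k i)
    (k : Fin K) (i : Fin 2) :
    ∫⁻ ω, component α β N k i 0 ω ∂P =
      ∑ j, ENNReal.ofReal (α k i j / β k i) * rate μ α β N P j := by
  have hpp := hN.pointProcess
  have hw : ∀ j, Measurable (weight α β k i j) := fun j => measurable_weight k i j
  have e : ∀ ω, component α β N k i 0 ω =
      ∑ j, ∫⁻ w, (Set.Iio 0).indicator (weight α β k i j) w ∂(N j ω) := fun ω => by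
    rw [component_eq, accumulated]
    simp [lintegral_indicator measurableSet_Iio]
  simp_rw [e]
  rw [lintegral_finsetSum]
  · refine Finset.sum_congr rfl fun j _ => ?_
    rw [hN.lintegral_lintegral hS j ((hw j).indicator measurableSet_Iio),
      lintegral_indicator measurableSet_Iio, Measure.restrict_congr_set Iio_ae_eq_Iic]
    congr 1
    simp_rw [weight]
    rw [← ofReal_integral_eq_lintegral_ofReal]
    · rw [integral_const_mul, integral_exp_mul_Iic (hβ k i)]
      simp [div_eq_mul_inv]
    · exact (integrableOn_exp_mul_Iic (hβ k i) 0).const_mul _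
    · exact Filter.Eventually.of_forall fun u => mul_nonneg (hα k i j) (Real.exp_pos _).le
  · intro j _
    simp_rw [lintegral_indicator measurableSet_Iio]
    exact (hpp.measurable_lintegral_Iio j (hw j)).comp measurable_prodMk_left

/-- The fixed-point identity m = μ + (∑ β_k⁻¹ α_k) m. No subcriticality is assumed: a finite
solution with μ > 0 is what yields invertibility and exponential decay. -/
theorem IsHawkes.rate_eq [IsProbabilityMeasure P] (hN : IsHawkes μ α β N P)
    (hS : IsSteadyState α β N P) (hα : ∀ k i j, 0 ≤ α k i j) (hβ : ∀ k i, 0 < β k i) (i : Fin 2) :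
    rate μ α β N P i = ENNReal.ofReal (μ i) +
      ∑ k, ∑ j, ENNReal.ofReal (α k i j / β k i) * rate μ α β N P j := by
  have hc : ∀ k, Measurable fun ω => component α β N k i 0 ω := fun k =>
    (hN.pointProcess.measurable_component k i).comp measurable_prodMk_left
  simp_rw [← hN.lintegral_component hS hα hβ]
  rw [rate]
  simp_rw [intensity]
  rw [lintegral_add_left (by fun_prop), lintegral_finsetSum _ fun k _ => hc k]
  simp

end Model

end Hawkes

/-! ### Linear Volterra systems: decay and asymptotics -/

namespace Hawkes

/-- Exponential decay for linear Volterra systems with nonnegative coupling which admit a strictly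
positive strict supersolution. -/
theorem exists_abs_le_exp_of_volterra {ι : Type*} [Fintype ι] {b v : ι → ℝ} {W : ι → ι → ℝ}
    {z : ι → ℝ → ℝ} (hW : ∀ i j, 0 ≤ W i j) (hv : ∀ i, 0 < v i)
    (hsuper : ∀ i, ∑ j, W i j * v j < b i * v i)
    (hz : ∀ i, ContinuousOn (z i) (Set.Ici 0))
    (heq : ∀ i t, 0 ≤ t → Real.exp (b i * t) * z i t =
      z i 0 + ∫ u in (0 : ℝ)..t, Real.exp (b i * u) * ∑ j, W i j * z j u) :
    ∃ C γ : ℝ, 0 < γ ∧ ∀ i t, 0 ≤ t → |z i t| ≤ C * Real.exp (-γ * t) := by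
  classical
  rcases isEmpty_or_nonempty ι with hι | hι
  · exact ⟨0, 1, one_pos, fun i => isEmptyElim i⟩
  -- γ is the smallest relative gap (b_i v_i - ∑ W_ij v_j) / v_i, positive because there are
  -- finitely many indices.
  obtain ⟨γ, hγ, hγv⟩ : ∃ γ : ℝ, 0 < γ ∧ ∀ i, ∑ j, W i j * v j ≤ (b i - γ) * v i := by
    obtain ⟨i0, hi0⟩ := Finite.exists_min fun i => (b i * v i - ∑ j, W i j * v j) / v i
    refine ⟨_, div_pos (sub_pos.2 (hsuper i0)) (hv i0), fun i => ?_⟩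
    have := hi0 i
    rw [le_div_iff₀ (hv i)] at this
    linarith
  obtain ⟨iC, hiC⟩ := Finite.exists_max fun i => |z i 0| / v i
  set C := |z iC 0| / v iC with hC
  -- A maximum principle for |z_i| e^{γt} / v_i: its largest value over all indices on [0, T] cannot
  -- exceed its largest value C at time 0.
  have key : ∀ T, 0 ≤ T → ∀ i, ∀ t ∈ Set.Icc 0 T, |z i t| * Real.exp (γ * t) / v i ≤ C := by
    intro T hT
    have hmax : ∀ i, ∃ t ∈ Set.Icc 0 T, ∀ s ∈ Set.Icc 0 T,
        |z i s| * Real.exp (γ * s) / v i ≤ |z i t| * Real.exp (γ * t) / v i := fun i => by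
      have hc : ContinuousOn (fun t => |z i t| * Real.exp (γ * t) / v i) (Set.Icc 0 T) :=
        ((((hz i).mono Set.Icc_subset_Ici_self).abs).mul (by fun_prop)).div_const _
      exact isCompact_Icc.exists_isMaxOn ⟨0, le_rfl, hT⟩ hc
    choose τ hτ hτmax using hmax
    obtain ⟨i, hi⟩ := Finite.exists_max fun i => |z i (τ i)| * Real.exp (γ * τ i) / v i
    set S := |z i (τ i)| * Real.exp (γ * τ i) / v i with hS
    have hbound : ∀ j, ∀ s ∈ Set.Icc 0 T, |z j s| ≤ S * v j * Real.exp (-γ * s) := fun j s hs => by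
      have h1 := (hτmax j s hs).trans (hi j)
      rw [div_le_iff₀ (hv j)] at h1
      have h2 : Real.exp (γ * s) * Real.exp (-γ * s) = 1 := by rw [← Real.exp_add]; simp
      calc |z j s| = |z j s| * Real.exp (γ * s) * Real.exp (-γ * s) := by
            rw [mul_assoc, h2, mul_one]
        _ ≤ _ := by gcongr
    suffices S ≤ C from fun j t ht => (hτmax j t ht).trans ((hi j).trans this)
    set t := τ i with ht
    have ht0 : 0 ≤ t := (hτ i).1
    have hS0 : 0 ≤ S := by
      have := hv i
      positivity
    have hint : |∫ u in (0 : ℝ)..t, Real.exp (b i * u) * ∑ j, W i j * z j u| ≤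
        ∫ u in (0 : ℝ)..t, S * v i * ((b i - γ) * Real.exp ((b i - γ) * u)) := by
      rw [← Real.norm_eq_abs]
      refine intervalIntegral.norm_integral_le_of_norm_le ht0
        (Filter.Eventually.of_forall fun u hu => ?_)
        (Continuous.intervalIntegrable (by fun_prop) _ _)
      have huT : u ∈ Set.Icc 0 T := ⟨hu.1.le, hu.2.trans (hτ i).2⟩
      rw [Real.norm_eq_abs, abs_mul, abs_of_pos (Real.exp_pos _)]
      calc Real.exp (b i * u) * |∑ j, W i j * z j u|
          ≤ Real.exp (b i * u) * ∑ j, W i j * (S * v j * Real.exp (-γ * u)) := by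
            gcongr
            refine (Finset.abs_sum_le_sum_abs _ _).trans (Finset.sum_le_sum fun j _ => ?_)
            rw [abs_mul, abs_of_nonneg (hW i j)]
            exact mul_le_mul_of_nonneg_left (hbound j u huT) (hW i j)
        _ = S * Real.exp ((b i - γ) * u) * ∑ j, W i j * v j := by
            rw [show (b i - γ) * u = b i * u + -γ * u by ring, Real.exp_add, Finset.mul_sum,
              Finset.mul_sum]
            exact Finset.sum_congr rfl fun j _ => by ring
        _ ≤ S * Real.exp ((b i - γ) * u) * ((b i - γ) * v i) := by
            gcongr
            exact hγv i
        _ = _ := by ring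
    have hprim : ∫ u in (0 : ℝ)..t, S * v i * ((b i - γ) * Real.exp ((b i - γ) * u)) =
        S * v i * (Real.exp ((b i - γ) * t) - 1) := by
      rw [intervalIntegral.integral_const_mul]
      congr 1
      have hd : ∀ u ∈ Set.uIcc 0 t, HasDerivAt (fun u => Real.exp ((b i - γ) * u))
          ((b i - γ) * Real.exp ((b i - γ) * u)) u := fun u _ => by
        simpa [mul_comm] using ((hasDerivAt_id u).const_mul (b i - γ)).exp
      rw [intervalIntegral.integral_eq_sub_of_hasDerivAt hd
        (Continuous.intervalIntegrable (by fun_prop) _ _)]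
      simp
    have hz0 : |z i 0| ≤ C * v i := by
      have := hiC i
      rwa [div_le_iff₀ (hv i)] at this
    -- The integral equation at the maximum point. The exponentials on the two sides cancel and
    -- leave S ≤ C.
    have hmain : S * v i * Real.exp ((b i - γ) * t) ≤
        C * v i + S * v i * (Real.exp ((b i - γ) * t) - 1) := by
      have h1 : S * v i = |z i t| * Real.exp (γ * t) := by
        rw [hS, div_mul_cancel₀ _ (hv i).ne']
      have h2 : S * v i * Real.exp ((b i - γ) * t) = |Real.exp (b i * t) * z i t| := by
        rw [h1, abs_mul, abs_of_pos (Real.exp_pos _), mul_assoc, ← Real.exp_add, mul_comm]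
        congr 2
        ring
      rw [h2, heq i t ht0, ← hprim]
      exact (abs_add_le _ _).trans (add_le_add hz0 hint)
    have := hv i
    have h3 : S * v i ≤ C * v i := by linarith
    exact le_of_mul_le_mul_right h3 this
  obtain ⟨iV, hiV⟩ := Finite.exists_max v
  have hC0 : 0 ≤ C := div_nonneg (abs_nonneg _) (hv _).le
  refine ⟨C * v iV, γ, hγ, fun i t ht => ?_⟩
  have h1 := key t ht i t ⟨ht, le_rfl⟩
  rw [div_le_iff₀ (hv i)] at h1
  have h2 : Real.exp (γ * t) * Real.exp (-γ * t) = 1 := by rw [← Real.exp_add]; simp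
  calc |z i t| = |z i t| * Real.exp (γ * t) * Real.exp (-γ * t) := by rw [mul_assoc, h2, mul_one]
    _ ≤ C * v i * Real.exp (-γ * t) := by gcongr
    _ ≤ _ := by
      gcongr
      exact hiV i

/-- The primitive of an exponentially decaying function converges exponentially fast. -/
theorem exists_abs_integral_sub_le {h : ℝ → ℝ} {C γ : ℝ} (hγ : 0 < γ)
    (hc : ContinuousOn h (Set.Ici 0)) (hb : ∀ t, 0 ≤ t → |h t| ≤ C * Real.exp (-γ * t)) :
    ∃ c : ℝ, ∀ t, 0 ≤ t → |(∫ u in (0 : ℝ)..t, h u) - c| ≤ C / γ * Real.exp (-γ * t) := by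
  have hexp : ∀ a : ℝ, IntegrableOn (fun t => C * Real.exp (-γ * t)) (Set.Ioi a) := fun a =>
    (exp_neg_integrableOn_Ioi a hγ).const_mul C
  have hint : ∀ a, 0 ≤ a → IntegrableOn h (Set.Ioi a) := fun a ha => by
    refine (hexp a).mono' ?_ ?_
    · exact (hc.mono fun x hx => ha.trans (le_of_lt hx)).aestronglyMeasurable measurableSet_Ioi
    · filter_upwards [ae_restrict_mem measurableSet_Ioi] with u hu
      exact hb u (ha.trans (le_of_lt hu))
  refine ⟨∫ u in Set.Ioi 0, h u, fun t ht => ?_⟩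
  have hsub : (∫ u in (0 : ℝ)..t, h u) - ∫ u in Set.Ioi 0, h u = -∫ u in Set.Ioi t, h u := by
    rw [← intervalIntegral.integral_Ioi_sub_Ioi (hint 0 le_rfl) ht]
    ring
  rw [hsub, abs_neg, ← Real.norm_eq_abs]
  refine (norm_integral_le_of_norm_le (hexp t) ?_).trans_eq ?_
  · filter_upwards [ae_restrict_mem measurableSet_Ioi] with u hu
    exact hb u (ht.trans (le_of_lt hu))
  · rw [integral_const_mul, integral_exp_mul_Ioi (by linarith)]
    field_simp

/-- Asymptotics of the linear Volterra system for the mixed moments of counts and intensities. -/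
theorem exists_abs_integral_sub_le_of_volterra {K : ℕ} {μ m : Fin 2 → ℝ}
    {α : Fin K → Matrix (Fin 2) (Fin 2) ℝ} {β : Fin K → Fin 2 → ℝ}
    (hμ : ∀ i, 0 < μ i) (hα : ∀ k i j, 0 ≤ α k i j) (hβ : ∀ k i, 0 < β k i)
    (hm0 : ∀ i, 0 ≤ m i) (hm : ∀ i, m i = μ i + ∑ k, (∑ j, α k i j * m j) / β k i)
    {s : Fin K → Fin 2 → ℝ} {d : ℝ} {p : Fin 2 → ℝ}
    (hp : ∀ i, p i = ∑ k, (s k i - (∑ j, α k i j * m j) / β k i * d + ∑ j, α k i j * p j) / β k i)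
    {X : Fin 2 → ℝ → ℝ} {Y : Fin K → Fin 2 → ℝ → ℝ}
    (hXi : ∀ j a b, IntervalIntegrable (X j) volume a b)
    (hX : ∀ j t, 0 ≤ t → X j t = μ j * (d * t) + ∑ k, Y k j t)
    (hY : ∀ k i t, 0 ≤ t → Real.exp (β k i * t) * Y k i t =
      ∫ u in (0 : ℝ)..t, Real.exp (β k i * u) * (s k i + ∑ j, α k i j * X j u)) :
    ∃ γ : ℝ, 0 < γ ∧ ∀ j, ∃ c C : ℝ, ∀ t, 0 ≤ t →
      |(∫ u in (0 : ℝ)..t, X j u) - (m j * d * t ^ 2 / 2 + p j * t) - c| ≤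
        C * Real.exp (-γ * t) := by
  -- Slope q and intercept r of the affine particular solution for Y. Summed over k they give (m_j -
  -- μ_j) d and p_j, so X has affine part m_j d t + p_j. The remainder z starts from -r, as Y
  -- vanishes at 0.
  set q : Fin K → Fin 2 → ℝ := fun k i => (∑ j, α k i j * m j) / β k i * d with hq
  set r : Fin K → Fin 2 → ℝ := fun k i => (s k i - q k i + ∑ j, α k i j * p j) / β k i with hr
  set z : Fin K × Fin 2 → ℝ → ℝ := fun i t => Y i.1 i.2 t - r i.1 i.2 - q i.1 i.2 * t with hz
  have hXz : ∀ j t, 0 ≤ t → X j t = m j * d * t + p j + ∑ k, z (k, j) t := fun j t ht => by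
    rw [hX j t ht, hm j, hp j]
    simp only [hz, hr, hq, Finset.sum_sub_distrib, ← Finset.sum_mul]
    ring
  have hbr : ∀ k i, β k i * r k i = s k i - q k i + ∑ j, α k i j * p j := fun k i => by
    rw [hr, mul_div_cancel₀ _ (hβ k i).ne']
  have hbq : ∀ k i, β k i * q k i = (∑ j, α k i j * m j) * d := fun k i => by
    rw [hq, ← mul_assoc, mul_div_cancel₀ _ (hβ k i).ne']
  have hFi : ∀ k i a b, IntervalIntegrable
      (fun u => Real.exp (β k i * u) * (s k i + ∑ j, α k i j * X j u)) volume a b := by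
    intro k i a b
    refine IntervalIntegrable.continuousOn_mul ?_ (by fun_prop)
    refine intervalIntegrable_const.add ?_
    have := IntervalIntegrable.sum (μ := volume) (a := a) (b := b) Finset.univ
      (f := fun j u => α k i j * X j u) fun j _ => (hXi j a b).const_mul _
    simpa [Finset.sum_fn] using this
  have hYc : ∀ k i, ContinuousOn (Y k i) (Set.Ici 0) := fun k i => by
    have h1 : Continuous fun t => Real.exp (-(β k i * t)) *
        ∫ u in (0 : ℝ)..t, Real.exp (β k i * u) * (s k i + ∑ j, α k i j * X j u) := by
      have := intervalIntegral.continuous_primitive (hFi k i) 0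
      fun_prop
    refine h1.continuousOn.congr fun t ht => ?_
    simp only
    rw [← hY k i t ht, ← mul_assoc, ← Real.exp_add]
    simp
  have hzc : ∀ i, ContinuousOn (z i) (Set.Ici 0) := fun i => by
    have := hYc i.1 i.2
    simp only [hz]
    fun_prop
  have hY0 : ∀ k i, Y k i 0 = 0 := fun k i => by simpa using hY k i 0 le_rfl
  have hz0 : ∀ k i, z (k, i) 0 = -r k i := fun k i => by simp [hz, hY0]
  have hzeq : ∀ k i t, 0 ≤ t → Real.exp (β k i * t) * z (k, i) t = z (k, i) 0 +
      ∫ u in (0 : ℝ)..t, Real.exp (β k i * u) * ∑ l : Fin K × Fin 2, α k i l.2 * z l u := by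
    intro k i t ht
    have hprim : ∫ u in (0 : ℝ)..t, Real.exp (β k i * u) * (β k i * (r k i + q k i * u) + q k i) =
        Real.exp (β k i * t) * (r k i + q k i * t) - r k i := by
      have hd : ∀ u ∈ Set.uIcc 0 t, HasDerivAt (fun u => Real.exp (β k i * u) * (r k i + q k i * u))
          (Real.exp (β k i * u) * (β k i * (r k i + q k i * u) + q k i)) u := fun u _ => by
        have h1 := ((hasDerivAt_id u).const_mul (β k i)).exp
        have h2 := ((hasDerivAt_id u).const_mul (q k i)).const_add (r k i)
        convert! h1.mul h2 using 1
        simp only [id]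
        ring
      rw [intervalIntegral.integral_eq_sub_of_hasDerivAt hd
        (Continuous.intervalIntegrable (by fun_prop) _ _)]
      simp
    have e : ∀ u ∈ Set.uIcc 0 t, Real.exp (β k i * u) * ∑ l : Fin K × Fin 2, α k i l.2 * z l u =
        Real.exp (β k i * u) * (s k i + ∑ j, α k i j * X j u) -
        Real.exp (β k i * u) * (β k i * (r k i + q k i * u) + q k i) := fun u hu => by
      rw [Set.uIcc_of_le ht] at hu
      rw [← mul_sub]
      congr 1
      simp_rw [hXz _ u hu.1]
      rw [mul_add (β k i), hbr, ← mul_assoc (β k i), hbq, Fintype.sum_prod_type_right]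
      simp only [mul_add, Finset.sum_add_distrib, Finset.mul_sum, Finset.sum_mul]
      have : ∀ j, α k i j * (m j * d * u) = α k i j * m j * d * u := fun j => by ring
      simp_rw [this]
      ring
    rw [intervalIntegral.integral_congr e, intervalIntegral.integral_sub (hFi k i 0 t)
      (Continuous.intervalIntegrable (by fun_prop) _ _), hprim, ← hY k i t ht, hz0]
    simp only [hz]
    ring
  -- a strict supersolution
  obtain ⟨ε, hε, hεμ⟩ : ∃ ε : ℝ, 0 < ε ∧ ∀ i, ε * ∑ k, 1 / β k i ≤ μ i := by
    have hw : ∀ i, 0 ≤ ∑ k, 1 / β k i := fun i =>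
      Finset.sum_nonneg fun k _ => (one_div_pos.2 (hβ k i)).le
    obtain ⟨i0, hi0⟩ := Finite.exists_min fun i => μ i / (1 + ∑ k, 1 / β k i)
    have hpos : ∀ i, 0 < 1 + ∑ k, 1 / β k i := fun i => by linarith [hw i]
    refine ⟨_, div_pos (hμ i0) (hpos i0), fun i => ?_⟩
    have h1 := hi0 i
    rw [le_div_iff₀ (hpos i)] at h1
    have h2 := div_pos (hμ i0) (hpos i0)
    linarith
  -- The supersolution is the vector of stationary component means, raised by ε / β. Summed over k
  -- it stays below m_j, so the coupling produces at most ∑ α m, while b v = ∑ α m + ε.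
  obtain ⟨C, γ, hγ, hdecay⟩ := exists_abs_le_exp_of_volterra (ι := Fin K × Fin 2)
    (b := fun i => β i.1 i.2) (v := fun i => (∑ j, α i.1 i.2 j * m j + ε) / β i.1 i.2)
    (W := fun i l => α i.1 i.2 l.2) (z := z) (fun i l => hα _ _ _)
    (fun i => div_pos (add_pos_of_nonneg_of_pos
      (Finset.sum_nonneg fun j _ => mul_nonneg (hα _ _ _) (hm0 _)) hε) (hβ _ _))
    (fun i => by
      rw [mul_div_cancel₀ _ (hβ _ _).ne', Fintype.sum_prod_type_right]
      have : ∀ j, ∑ k, α i.1 i.2 j * ((∑ l, α k j l * m l + ε) / β k j) ≤ α i.1 i.2 j * m j := by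
        intro j
        rw [← Finset.mul_sum]
        refine mul_le_mul_of_nonneg_left ?_ (hα _ _ _)
        simp_rw [add_div, Finset.sum_add_distrib]
        have h1 : ∑ k, ε / β k j = ε * ∑ k, 1 / β k j := by
          rw [Finset.mul_sum]
          exact Finset.sum_congr rfl fun k _ => by ring
        have := hm j
        rw [h1]
        linarith [hεμ j]
      exact (Finset.sum_le_sum fun j _ => this j).trans_lt (lt_add_of_pos_right _ hε))
    hzc (fun i t ht => hzeq i.1 i.2 t ht)
  refine ⟨γ, hγ, fun j => ?_⟩
  obtain ⟨c, hc⟩ := exists_abs_integral_sub_le (h := fun t => ∑ k, z (k, j) t) (C := K * C) hγ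
    (continuousOn_finsetSum _ fun k _ => hzc (k, j)) (fun t ht => by
      refine (Finset.abs_sum_le_sum_abs _ _).trans
        ((Finset.sum_le_sum fun k _ => hdecay (k, j) t ht).trans_eq ?_)
      simp [mul_assoc])
  refine ⟨c, K * C / γ, fun t ht => ?_⟩
  have hI : ∫ u in (0 : ℝ)..t, X j u =
      m j * d * t ^ 2 / 2 + p j * t + ∫ u in (0 : ℝ)..t, ∑ k, z (k, j) u := by
    have hzi : IntervalIntegrable (fun u => ∑ k, z (k, j) u) volume 0 t := by
      refine ContinuousOn.intervalIntegrable ?_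
      refine (continuousOn_finsetSum _ fun k _ => hzc (k, j)).mono ?_
      rw [Set.uIcc_of_le ht]
      exact Set.Icc_subset_Ici_self
    rw [intervalIntegral.integral_congr (g := fun u => m j * d * u + p j + ∑ k, z (k, j) u)
      (fun u hu => hXz j u (by rw [Set.uIcc_of_le ht] at hu; exact hu.1)),
      intervalIntegral.integral_add (Continuous.intervalIntegrable (by fun_prop) _ _) hzi,
      intervalIntegral.integral_add (Continuous.intervalIntegrable (by fun_prop) _ _)
        intervalIntegrable_const, intervalIntegral.integral_const_mul, integral_id]
    simp
    ring
  rw [hI, add_sub_cancel_left]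
  exact hc t ht

end Hawkes

/-! ### Invertibility of I minus the branching matrix -/

namespace Hawkes

section Algebra

variable {K : ℕ} {μ m : Fin 2 → ℝ} {α : Fin K → Matrix (Fin 2) (Fin 2) ℝ} {β : Fin K → Fin 2 → ℝ}

theorem inv_diagonal_mulVec (hβ : ∀ k i, 0 < β k i) (k : Fin K) (v : Fin 2 → ℝ) (i : Fin 2) :
    Matrix.mulVec (Matrix.diagonal (β k))⁻¹ v i = v i / β k i := by
  have h : (Matrix.diagonal (β k))⁻¹ = Matrix.diagonal fun i => (β k i)⁻¹ := by
    refine Matrix.inv_eq_right_inv ?_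
    rw [Matrix.diagonal_mul_diagonal, ← Matrix.diagonal_one]
    congr 1
    funext i
    exact mul_inv_cancel₀ (hβ k i).ne'
  rw [h, Matrix.mulVec_diagonal, div_eq_inv_mul]

theorem branching_mulVec (hβ : ∀ k i, 0 < β k i) (v : Fin 2 → ℝ) (i : Fin 2) :
    Matrix.mulVec (branching α β) v i = ∑ k, (∑ j, α k i j * v j) / β k i := by
  rw [branching, Matrix.sum_mulVec, Finset.sum_apply]
  refine Finset.sum_congr rfl fun k _ => ?_
  rw [← Matrix.mulVec_mulVec, inv_diagonal_mulVec hβ]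
  rfl

/-- A kernel vector v is fixed by the nonnegative branching matrix. At the index where c = |v_i| /
m_i is largest, comparison with m gives c m_i = |v_i| ≤ c (m_i - μ_i), and μ_i > 0 forces c = 0. -/
theorem isUnit_det_one_sub_branching (hμ : ∀ i, 0 < μ i) (hα : ∀ k i j, 0 ≤ α k i j)
    (hβ : ∀ k i, 0 < β k i) (hm0 : ∀ i, 0 ≤ m i)
    (hm : ∀ i, m i = μ i + ∑ k, (∑ j, α k i j * m j) / β k i) :
    IsUnit (1 - branching α β).det := by
  rw [isUnit_iff_ne_zero]
  intro hdet
  obtain ⟨v, hv0, hv⟩ := Matrix.exists_mulVec_eq_zero_iff.2 hdet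
  have hmpos : ∀ i, 0 < m i := fun i => by
    rw [hm i]
    exact add_pos_of_pos_of_nonneg (hμ i) (Finset.sum_nonneg fun k _ =>
      div_nonneg (Finset.sum_nonneg fun j _ => mul_nonneg (hα _ _ _) (hm0 j)) (hβ _ _).le)
  have hfix : ∀ i, v i = ∑ k, (∑ j, α k i j * v j) / β k i := fun i => by
    have := congrFun hv i
    rw [Matrix.sub_mulVec, Matrix.one_mulVec, Pi.sub_apply, branching_mulVec hβ] at this
    exact sub_eq_zero.1 this
  obtain ⟨i, hi⟩ := Finite.exists_max fun i => |v i| / m i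
  set c := |v i| / m i with hc
  have hle : ∀ j, |v j| ≤ c * m j := fun j => (div_le_iff₀ (hmpos j)).1 (hi j)
  have hc0 : 0 ≤ c := div_nonneg (abs_nonneg _) (hm0 i)
  have h1 : |v i| ≤ c * (m i - μ i) := by
    have h2 : m i - μ i = ∑ k, (∑ j, α k i j * m j) / β k i := by linarith [hm i]
    rw [h2]
    conv_lhs => rw [hfix i]
    rw [Finset.mul_sum]
    refine (Finset.abs_sum_le_sum_abs _ _).trans (Finset.sum_le_sum fun k _ => ?_)
    rw [abs_div, abs_of_pos (hβ k i), ← mul_div_assoc]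
    refine div_le_div_of_nonneg_right ?_ (hβ k i).le
    rw [Finset.mul_sum]
    refine (Finset.abs_sum_le_sum_abs _ _).trans (Finset.sum_le_sum fun j _ => ?_)
    rw [abs_mul, abs_of_nonneg (hα k i j), mul_left_comm]
    exact mul_le_mul_of_nonneg_left (hle j) (hα k i j)
  have h3 : |v i| = c * m i := by rw [hc, div_mul_cancel₀ _ (hmpos i).ne']
  have hcz : c = 0 := by nlinarith [hμ i]
  refine hv0 (funext fun j => ?_)
  have := hle j
  rw [hcz, zero_mul] at this
  exact abs_nonpos_iff.1 this

end Algebra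

/-! ### Real-valued moments, the matrix B and the exact variance -/

noncomputable section Model

variable {Ω : Type*} [MeasurableSpace Ω] {P : Measure Ω} [IsProbabilityMeasure P]
  {K : ℕ} {μ : Fin 2 → ℝ} {α : Fin K → Matrix (Fin 2) (Fin 2) ℝ} {β : Fin K → Fin 2 → ℝ}
  {N : Fin 2 → Kernel Ω ℝ}

theorem IsHawkes.rate_toReal_eq (hN : IsHawkes μ α β N P) (hS : IsSteadyState α β N P)
    (hμ : ∀ i, 0 < μ i) (hα : ∀ k i j, 0 ≤ α k i j) (hβ : ∀ k i, 0 < β k i) (i : Fin 2) :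
    (rate μ α β N P i).toReal =
      μ i + ∑ k, (∑ j, α k i j * (rate μ α β N P j).toReal) / β k i := by
  have hr := fun j => (hS.rate_lt_top (μ := μ) hN.pointProcess j).ne
  have hf : ∀ k j, ENNReal.ofReal (α k i j / β k i) * rate μ α β N P j ≠ ∞ := fun k j =>
    ENNReal.mul_ne_top (by finiteness) (hr j)
  conv_lhs => rw [hN.rate_eq hS hα hβ i]
  rw [ENNReal.toReal_add (by finiteness) (ENNReal.sum_ne_top.2 fun k _ =>
    ENNReal.sum_ne_top.2 fun j _ => hf k j), ENNReal.toReal_ofReal (hμ i).le,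
    ENNReal.toReal_sum fun k _ => ENNReal.sum_ne_top.2 fun j _ => hf k j]
  congr 1
  refine Finset.sum_congr rfl fun k _ => ?_
  rw [ENNReal.toReal_sum fun j _ => hf k j, Finset.sum_div]
  refine Finset.sum_congr rfl fun j _ => ?_
  rw [ENNReal.toReal_mul, ENNReal.toReal_ofReal (div_nonneg (hα k i j) (hβ k i).le)]
  ring

theorem IsHawkes.meanIntensity_eq (hN : IsHawkes μ α β N P) (hS : IsSteadyState α β N P) (t : ℝ) :
    meanIntensity μ α β N P t = fun i => (rate μ α β N P i).toReal := by
  funext i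
  have hm : Measurable fun ω => intensity μ α β N i t ω :=
    hN.pointProcess.measurable_intensity_apply i t
  rw [meanIntensity, integral_toReal hm.aemeasurable, hS.lintegral_intensity]
  refine ae_lt_top hm ?_
  rw [hS.lintegral_intensity]
  exact (hS.rate_lt_top hN.pointProcess i).ne

theorem IsHawkes.crossMoment_eq (hN : IsHawkes μ α β N P) (hS : IsSteadyState α β N P) (k : Fin K)
    (t : ℝ) (i j : Fin 2) :
    crossMoment μ α β N P k t i j = (componentIntensity μ α β N P k i j).toReal := by
  have hm : Measurable fun ω => intensity μ α β N j t ω :=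
    hN.pointProcess.measurable_intensity_apply j t
  have hc : Measurable fun ω => component α β N k i t ω :=
    (hN.pointProcess.measurable_component k i).comp measurable_prodMk_left
  have hmc : Measurable fun ω => component α β N k i t ω * intensity μ α β N j t ω := hc.mul hm
  rw [crossMoment, Matrix.of_apply]
  simp_rw [← ENNReal.toReal_mul]
  rw [integral_toReal hmc.aemeasurable, hS.lintegral_component_mul_intensity]
  refine ae_lt_top hmc ?_
  rw [hS.lintegral_component_mul_intensity]
  exact (hS.componentIntensity_lt_top hN.pointProcess k i j).ne

theorem IsHawkes.countIntensity_lt_top (hN : IsHawkes μ α β N P) (hS : IsSteadyState α β N P)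
    (a j : Fin 2) (t : ℝ) : countIntensity μ α β N P a j t < ∞ := by
  obtain ⟨B, hB, h⟩ := hN.exists_countIntensity_le hS a j (T := |t| + 1) (by positivity)
  exact (h t ((le_abs_self t).trans (by linarith))).trans_lt hB

theorem IsHawkes.intervalIntegrable_countIntensity (hN : IsHawkes μ α β N P)
    (hS : IsSteadyState α β N P) (a j : Fin 2) (x y : ℝ) :
    IntervalIntegrable (fun t => (countIntensity μ α β N P a j t).toReal) volume x y := by
  obtain ⟨B, hB, h⟩ := hN.exists_countIntensity_le hS a j (T := |x| + |y| + 1) (by positivity)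
  have hm : Measurable fun t => (countIntensity μ α β N P a j t).toReal :=
    (hN.pointProcess.measurable_countIntensity a j).ennreal_toReal
  rw [intervalIntegrable_iff]
  refine Measure.integrableOn_of_bounded (M := B.toReal) ?_ hm.aestronglyMeasurable ?_
  · simp
  · filter_upwards [ae_restrict_mem measurableSet_uIoc] with t ht
    rw [Real.norm_eq_abs, abs_of_nonneg ENNReal.toReal_nonneg]
    refine ENNReal.toReal_mono hB.ne (h t ?_)
    have h1 : t ≤ max x y := ht.2
    have h2 := le_abs_self x
    have h3 := le_abs_self y
    have h4 := abs_nonneg x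
    have h5 := abs_nonneg y
    rcases le_max_iff.1 h1 with h | h <;> linarith

theorem IsHawkes.countIntensity_toReal_eq (hN : IsHawkes μ α β N P) (hS : IsSteadyState α β N P)
    (hμ : ∀ i, 0 < μ i) (a j : Fin 2) {t : ℝ} (ht : 0 ≤ t) :
    (countIntensity μ α β N P a j t).toReal = μ j * ((rate μ α β N P a).toReal * t) +
      ∑ k, (countComponent α β N P a k j t).toReal := by
  have h := hN.countIntensity_eq hS a j t
  have hfin := (hN.countIntensity_lt_top hS a j t).ne
  rw [h, ENNReal.add_ne_top] at hfin
  rw [h, ENNReal.toReal_add hfin.1 hfin.2, ENNReal.toReal_sum (ENNReal.sum_ne_top.1 hfin.2)]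
  simp [ENNReal.toReal_ofReal (hμ j).le, ENNReal.toReal_ofReal ht]

theorem IsHawkes.countComponent_toReal_eq (hN : IsHawkes μ α β N P) (hS : IsSteadyState α β N P)
    (hα : ∀ k i j, 0 ≤ α k i j) (a : Fin 2) (k : Fin K) (i : Fin 2) {t : ℝ} (ht : 0 ≤ t) :
    Real.exp (β k i * t) * (countComponent α β N P a k i t).toReal =
      ∫ u in (0 : ℝ)..t, Real.exp (β k i * u) * ((componentIntensity μ α β N P k i a).toReal +
        α k i a * (rate μ α β N P a).toReal +
          ∑ j, α k i j * (countIntensity μ α β N P a j u).toReal) := by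
  have h := congrArg ENNReal.toReal (hN.countComponent_eq hS a k i t)
  rw [ENNReal.toReal_mul, ENNReal.toReal_ofReal (Real.exp_pos _).le] at h
  have hX := fun j => hN.pointProcess.measurable_countIntensity (P := P) (μ := μ) (α := α) (β := β) a j
  have hXt := fun j u => (hN.countIntensity_lt_top hS a j u).ne
  have hr := (hS.rate_lt_top (μ := μ) hN.pointProcess a).ne
  have hc := (hS.componentIntensity_lt_top (μ := μ) hN.pointProcess k i a).ne
  have hXa : ∀ j u, ENNReal.ofReal (α k i j) * countIntensity μ α β N P a j u ≠ ∞ := fun j u =>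
    ENNReal.mul_ne_top ENNReal.ofReal_ne_top (hXt j u)
  have hra : ENNReal.ofReal (α k i a) * rate μ α β N P a ≠ ∞ :=
    ENNReal.mul_ne_top ENNReal.ofReal_ne_top hr
  have hsum : ∀ u, ∑ j, ENNReal.ofReal (α k i j) * countIntensity μ α β N P a j u ≠ ∞ := fun u =>
    ENNReal.sum_ne_top.2 fun j _ => hXa j u
  rw [h, intervalIntegral.integral_of_le ht, integral_Ioc_eq_integral_Ioo, ← integral_toReal]
  · refine integral_congr_ae (Filter.Eventually.of_forall fun u => ?_)
    simp only
    rw [ENNReal.toReal_mul, ENNReal.toReal_ofReal (Real.exp_pos _).le,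
      ENNReal.toReal_add (ENNReal.add_ne_top.2 ⟨hc, hra⟩) (hsum u), ENNReal.toReal_add hc hra,
      ENNReal.toReal_sum fun j _ => hXa j u]
    simp only [ENNReal.toReal_mul, ENNReal.toReal_ofReal (hα k i _)]
  · exact Measurable.aemeasurable (by fun_prop)
  · refine Filter.Eventually.of_forall fun u => ?_
    exact ENNReal.mul_lt_top ENNReal.ofReal_lt_top
      (ENNReal.add_lt_top.2 ⟨(ENNReal.add_ne_top.2 ⟨hc, hra⟩).lt_top, (hsum u).lt_top⟩)

theorem measurable_count (a : Fin 2) (t : ℝ) :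
    Measurable (count N a t) :=
  ((N a).measurable_coe measurableSet_Ioc).ennreal_toReal

theorem IsHawkes.memLp_count (hN : IsHawkes μ α β N P) (hS : IsSteadyState α β N P) (a : Fin 2)
    {t : ℝ} (ht : 0 ≤ t) : MemLp (count N a t) 2 P := by
  refine ⟨(measurable_count a t).aestronglyMeasurable, ?_⟩
  rw [eLpNorm_lt_top_iff_lintegral_rpow_enorm_lt_top two_ne_zero ENNReal.ofNat_ne_top]
  have : ∀ ω, ‖count N a t ω‖ₑ ^ (2 : ℝ≥0∞).toReal = N a ω (Set.Ioc 0 t) ^ 2 := fun ω => by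
    rw [count, Real.enorm_eq_ofReal ENNReal.toReal_nonneg, ENNReal.ofReal_toReal
      ((hN.pointProcess.configuration a ω).measure_Ioc_lt_top 0 t).ne]
    simp
  simp_rw [this]
  rcases ht.eq_or_lt with rfl | ht
  · simp
  · exact hN.lintegral_count_sq hS a ht

theorem IsHawkes.integral_count (hN : IsHawkes μ α β N P) (hS : IsSteadyState α β N P) (a : Fin 2)
    {t : ℝ} (ht : 0 ≤ t) : ∫ ω, count N a t ω ∂P = (rate μ α β N P a).toReal * t := by
  simp_rw [count]
  rw [integral_toReal ((N a).measurable_coe measurableSet_Ioc).aemeasurable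
    (Filter.Eventually.of_forall fun ω =>
      (hN.pointProcess.configuration a ω).measure_Ioc_lt_top 0 t), hN.lintegral_Ioc hS,
    ENNReal.toReal_mul, sub_zero, ENNReal.toReal_ofReal ht]

theorem IsHawkes.integral_count_mul (hN : IsHawkes μ α β N P) (hS : IsSteadyState α β N P)
    (a b : Fin 2) {t : ℝ} (ht : 0 ≤ t) : ∫ ω, count N a t ω * count N b t ω ∂P =
      (∫ u in (0 : ℝ)..t, (countIntensity μ α β N P b a u).toReal) +
      (∫ u in (0 : ℝ)..t, (countIntensity μ α β N P a b u).toReal) +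
        if a = b then t * (rate μ α β N P a).toReal else 0 := by
  have hmeas : ∀ a, Measurable fun ω => N a ω (Set.Ioc 0 t) := fun a =>
    (N a).measurable_coe measurableSet_Ioc
  have hfin : ∀ a ω, N a ω (Set.Ioc 0 t) < ∞ := fun a ω =>
    (hN.pointProcess.configuration a ω).measure_Ioc_lt_top 0 t
  have hint : ∀ a b, ∫ u in (0 : ℝ)..t, (countIntensity μ α β N P a b u).toReal =
      (∫⁻ u in Set.Ioc 0 t, countIntensity μ α β N P a b u).toReal := fun a b => by
    rw [intervalIntegral.integral_of_le ht, integral_toReal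
      (hN.pointProcess.measurable_countIntensity a b).aemeasurable
      (Filter.Eventually.of_forall fun u => hN.countIntensity_lt_top hS a b u)]
  have htop : ∀ a b, ∫⁻ u in Set.Ioc 0 t, countIntensity μ α β N P a b u ≠ ∞ := fun a b => by
    obtain ⟨B, hB, h⟩ := hN.exists_countIntensity_le hS a b (T := t + 1) (by positivity)
    refine (lt_of_le_of_lt (setLIntegral_mono measurable_const fun u hu => h u ?_) ?_ :
      _ < (∞ : ℝ≥0∞)).ne
    · linarith [hu.2]
    · rw [setLIntegral_const, Real.volume_Ioc]
      finiteness
  have hr := (hS.rate_lt_top (μ := μ) hN.pointProcess a).ne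
  have hab : Measurable fun ω => N a ω (Set.Ioc 0 t) * N b ω (Set.Ioc 0 t) := (hmeas a).mul (hmeas b)
  simp_rw [count, ← ENNReal.toReal_mul]
  rw [integral_toReal hab.aemeasurable (Filter.Eventually.of_forall fun ω =>
    ENNReal.mul_lt_top (hfin a ω) (hfin b ω)), hN.lintegral_count_mul hS a b t, hint, hint,
    ENNReal.toReal_add (ENNReal.add_ne_top.2 ⟨htop b a, htop a b⟩) (by split_ifs <;> finiteness),
    ENNReal.toReal_add (htop b a) (htop a b)]
  congr 1
  split_ifs
  · rw [ENNReal.toReal_mul, ENNReal.toReal_ofReal ht]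
  · simp

/-- `B (1, -1)ᵀ` solves the linear system for the limits of the mixed moments. -/
theorem IsHawkes.matrixB_mulVec_eq (hN : IsHawkes μ α β N P) (hS : IsSteadyState α β N P)
    (hμ : ∀ i, 0 < μ i) (hα : ∀ k i j, 0 ≤ α k i j) (hβ : ∀ k i, 0 < β k i) (t : ℝ)
    {m : Fin 2 → ℝ} (hm : m = fun i => (rate μ α β N P i).toReal) (i : Fin 2) :
    Matrix.mulVec (matrixB μ α β N P t) ![1, -1] i =
      ∑ k, ((componentIntensity μ α β N P k i 0).toReal + α k i 0 * m 0 -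
        ((componentIntensity μ α β N P k i 1).toReal + α k i 1 * m 1) -
        (∑ j, α k i j * m j) / β k i * (m 0 - m 1) +
        ∑ j, α k i j * Matrix.mulVec (matrixB μ α β N P t) ![1, -1] j) / β k i := by
  have hmeq : ∀ i, m i = μ i + ∑ k, (∑ j, α k i j * m j) / β k i := fun i => by
    simp only [hm]
    exact hN.rate_toReal_eq hS hμ hα hβ i
  have hm0 : ∀ i, 0 ≤ m i := fun i => by simp [hm]
  have hu := isUnit_det_one_sub_branching hμ hα hβ hm0 hmeq
  -- By the rate identity A is the rank-one matrix m mᵀ, so A(1,-1)ᵀ = (m_0 - m_1) m.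
  have hinv : Matrix.mulVec (1 - branching α β)⁻¹ μ = m := by
    have : μ = Matrix.mulVec (1 - branching α β) m := by
      funext i
      rw [Matrix.sub_mulVec, Matrix.one_mulVec, Pi.sub_apply, branching_mulVec hβ]
      linarith [hmeq i]
    conv_lhs => rw [this]
    rw [Matrix.mulVec_mulVec, Matrix.nonsing_inv_mul _ hu, Matrix.one_mulVec]
  have hmean : meanIntensity μ α β N P t = m := by rw [hN.meanIntensity_eq hS, hm]
  have hA : Matrix.mulVec (matrixA μ α β N P t) ![1, -1] = fun i => m i * (m 0 - m 1) := by
    rw [matrixA, hinv, hmean]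
    funext i
    simp [Matrix.mulVec, dotProduct, Matrix.vecMulVec_apply]
    ring
  have hB : Matrix.mulVec (1 - branching α β)
      (Matrix.mulVec (matrixB μ α β N P t) ![1, -1]) i = ∑ k,
      ((componentIntensity μ α β N P k i 0).toReal + α k i 0 * m 0 -
        ((componentIntensity μ α β N P k i 1).toReal + α k i 1 * m 1) -
        (∑ j, α k i j * m j) / β k i * (m 0 - m 1)) / β k i := by
    rw [matrixB, Matrix.mulVec_mulVec, ← mul_assoc, Matrix.mul_nonsing_inv _ hu, one_mul,
      Matrix.sum_mulVec, Finset.sum_apply]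
    refine Finset.sum_congr rfl fun k _ => ?_
    rw [← Matrix.mulVec_mulVec, inv_diagonal_mulVec hβ]
    congr 1
    rw [Matrix.add_mulVec, Matrix.add_mulVec, Matrix.neg_mulVec, ← Matrix.mulVec_mulVec, hA,
      ← Matrix.mulVec_mulVec, ← Matrix.mulVec_mulVec, Pi.add_apply, Pi.add_apply, Pi.neg_apply,
      inv_diagonal_mulVec hβ, hmean]
    simp only [Matrix.mulVec, dotProduct, Fin.sum_univ_two, hN.crossMoment_eq hS,
      Matrix.diagonal_apply]
    simp
    ring
  rw [Matrix.sub_mulVec, Matrix.one_mulVec, Pi.sub_apply, branching_mulVec hβ,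
    sub_eq_iff_eq_add, ← Finset.sum_add_distrib] at hB
  rw [hB]
  exact Finset.sum_congr rfl fun k _ => by rw [← add_div]

/-- Expand the square and insert the second moments of the counts. Terms are grouped by the index of
the intensity, because the Volterra system is solved for the difference over the index of the count.
-/
theorem IsHawkes.variance_eq (hN : IsHawkes μ α β N P) (hS : IsSteadyState α β N P)
    {t : ℝ} (ht : 0 ≤ t) :
    variance (fun ω => count N 0 t ω - count N 1 t ω) P =
      2 * ((∫ u in (0 : ℝ)..t, ((countIntensity μ α β N P 0 0 u).toReal -
          (countIntensity μ α β N P 1 0 u).toReal)) -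
        ∫ u in (0 : ℝ)..t, ((countIntensity μ α β N P 0 1 u).toReal -
          (countIntensity μ α β N P 1 1 u).toReal)) +
        ((rate μ α β N P 0).toReal + (rate μ α β N P 1).toReal) * t -
        (((rate μ α β N P 0).toReal - (rate μ α β N P 1).toReal) * t) ^ 2 := by
  have hL := fun a => hN.memLp_count hS a ht
  have hI := fun a => (hL a).integrable one_le_two
  have hII : ∀ a b, Integrable (fun ω => count N a t ω * count N b t ω) P := fun a b =>
    (hL a).integrable_mul (hL b)
  have hi := hN.intervalIntegrable_countIntensity hS
  have hD : MemLp (fun ω => count N 0 t ω - count N 1 t ω) 2 P := (hL 0).sub (hL 1)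
  rw [variance_eq_sub hD, integral_sub (hI 0) (hI 1), hN.integral_count hS 0 ht,
    hN.integral_count hS 1 ht]
  have e : ∫ ω, ((fun ω => count N 0 t ω - count N 1 t ω) ^ 2) ω ∂P =
      ∫ ω, count N 0 t ω * count N 0 t ω ∂P - 2 * ∫ ω, count N 0 t ω * count N 1 t ω ∂P +
        ∫ ω, count N 1 t ω * count N 1 t ω ∂P := by
    have hsub : Integrable (fun ω => count N 0 t ω * count N 0 t ω -
      2 * (count N 0 t ω * count N 1 t ω)) P := (hII 0 0).sub ((hII 0 1).const_mul 2)
    rw [← integral_const_mul, ← integral_sub (hII 0 0) ((hII 0 1).const_mul 2),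
      ← integral_add hsub (hII 1 1)]
    refine integral_congr_ae (Filter.Eventually.of_forall fun ω => ?_)
    simp only [Pi.pow_apply]
    ring
  rw [e, hN.integral_count_mul hS 0 0 ht, hN.integral_count_mul hS 0 1 ht,
    hN.integral_count_mul hS 1 1 ht, intervalIntegral.integral_sub (hi 0 0 _ _) (hi 1 0 _ _),
    intervalIntegral.integral_sub (hi 0 1 _ _) (hi 1 1 _ _)]
  simp only [if_true, if_neg (show (0 : Fin 2) ≠ 1 by decide)]
  ring

end Model

end Hawkes

/-! ### Assembly of the asymptotics -/

theorem proposition5 {Ω : Type*} [MeasurableSpace Ω] (P : Measure Ω) [IsProbabilityMeasure P]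
    {K : ℕ} (μ : Fin 2 → ℝ) (α : Fin K → Matrix (Fin 2) (Fin 2) ℝ) (β : Fin K → Fin 2 → ℝ)
    (hμ : ∀ i, 0 < μ i) (hα : ∀ k i j, 0 ≤ α k i j) (hβ : ∀ k i, 0 < β k i)
    (N : Fin 2 → Kernel Ω ℝ) (hN : Hawkes.IsHawkes μ α β N P)
    (hS : Hawkes.IsSteadyState α β N P) :
    IsUnit (1 - Hawkes.branching α β).det ∧
    (∀ t : ℝ, 0 ≤ t → MemLp (fun ω => Hawkes.count N 0 t ω - Hawkes.count N 1 t ω) 2 P) ∧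
    ∃ c C γ : ℝ, 0 < γ ∧ ∀ t : ℝ, 0 ≤ t →
      |variance (fun ω => Hawkes.count N 0 t ω - Hawkes.count N 1 t ω) P
        - (2 * (![1, -1] ⬝ᵥ Matrix.mulVec (Hawkes.matrixB μ α β N P t) ![1, -1])
            + ![1, 1] ⬝ᵥ Hawkes.meanIntensity μ α β N P t) * t - c|
        ≤ C * Real.exp (-γ * t) := by
  set m : Fin 2 → ℝ := fun i => (Hawkes.rate μ α β N P i).toReal with hm
  have hm0 : ∀ i, 0 ≤ m i := fun i => ENNReal.toReal_nonneg
  have hmeq : ∀ i, m i = μ i + ∑ k, (∑ j, α k i j * m j) / β k i :=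
    hN.rate_toReal_eq hS hμ hα hβ
  refine ⟨Hawkes.isUnit_det_one_sub_branching hμ hα hβ hm0 hmeq,
    fun t ht => (hN.memLp_count hS 0 ht).sub (hN.memLp_count hS 1 ht), ?_⟩
  have hmean : ∀ t, Hawkes.meanIntensity μ α β N P t = m := fun t => hN.meanIntensity_eq hS t
  have hBt : ∀ t, Hawkes.matrixB μ α β N P t = Hawkes.matrixB μ α β N P 0 := fun t => by
    have hc : ∀ k, Hawkes.crossMoment μ α β N P k t = Hawkes.crossMoment μ α β N P k 0 := fun k => by
      ext i j
      rw [hN.crossMoment_eq hS, hN.crossMoment_eq hS]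
    simp only [Hawkes.matrixB, Hawkes.matrixA, hmean, hc]
  set p := Matrix.mulVec (Hawkes.matrixB μ α β N P 0) ![1, -1] with hp
  have hi := hN.intervalIntegrable_countIntensity hS
  -- The moment equations are affine with the same coupling for both counts, so their difference is
  -- again such a system, with d = m_0 - m_1; its constant term is B(1,-1)ᵀ.
  obtain ⟨γ, hγ, h⟩ := Hawkes.exists_abs_integral_sub_le_of_volterra hμ hα hβ hm0 hmeq
    (d := m 0 - m 1) (hN.matrixB_mulVec_eq hS hμ hα hβ 0 hm)
    (X := fun j t => (Hawkes.countIntensity μ α β N P 0 j t).toReal -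
      (Hawkes.countIntensity μ α β N P 1 j t).toReal)
    (Y := fun k i t => (Hawkes.countComponent α β N P 0 k i t).toReal -
      (Hawkes.countComponent α β N P 1 k i t).toReal)
    (fun j a b => (hi 0 j a b).sub (hi 1 j a b))
    (fun j t ht => by
      rw [hN.countIntensity_toReal_eq hS hμ 0 j ht, hN.countIntensity_toReal_eq hS hμ 1 j ht,
        Finset.sum_sub_distrib]
      ring)
    (fun k i t ht => by
      have hFi : ∀ a : Fin 2, IntervalIntegrable (fun u => Real.exp (β k i * u) *
          ((Hawkes.componentIntensity μ α β N P k i a).toReal +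
          α k i a * (Hawkes.rate μ α β N P a).toReal +
          ∑ j, α k i j * (Hawkes.countIntensity μ α β N P a j u).toReal)) volume 0 t := by
        intro a
        refine IntervalIntegrable.continuousOn_mul ?_ (by fun_prop)
        refine intervalIntegrable_const.add ?_
        have := IntervalIntegrable.sum (μ := volume) (a := 0) (b := t) Finset.univ
          (f := fun j u => α k i j * (Hawkes.countIntensity μ α β N P a j u).toReal)
          fun j _ => (hi a j 0 t).const_mul _
        simpa [Finset.sum_fn] using this
      rw [mul_sub, hN.countComponent_toReal_eq hS hα 0 k i ht,
        hN.countComponent_toReal_eq hS hα 1 k i ht, ← intervalIntegral.integral_sub (hFi 0) (hFi 1)]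
      refine intervalIntegral.integral_congr fun u _ => ?_
      simp only [mul_sub, Finset.sum_sub_distrib, hm]
      ring)
  obtain ⟨c0, C0, h0⟩ := h 0
  obtain ⟨c1, C1, h1⟩ := h 1
  refine ⟨2 * (c0 - c1), 2 * (C0 + C1), γ, hγ, fun t ht => ?_⟩
  rw [hN.variance_eq hS ht, hmean, hBt, ← hp]
  have e0 := abs_le.1 (h0 t ht)
  have e1 := abs_le.1 (h1 t ht)
  rw [← hp] at e0 e1
  have hd1 : ![1, -1] ⬝ᵥ p = p 0 - p 1 := by simp [dotProduct, Fin.sum_univ_two, sub_eq_add_neg]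
  have hd2 : ![1, 1] ⬝ᵥ m = m 0 + m 1 := by simp [dotProduct, Fin.sum_univ_two]
  rw [hd1, hd2, show (Hawkes.rate μ α β N P 0).toReal = m 0 from rfl,
    show (Hawkes.rate μ α β N P 1).toReal = m 1 from rfl]
  generalize Real.exp (-γ * t) = E at e0 e1 ⊢
  rw [abs_le]
  -- The quadratic parts 2 (m_0 d t²/2 - m_1 d t²/2) = (d t)² cancel exactly against the squared
  -- mean.
  constructor <;> linarith [e0.1, e0.2, e1.1, e1.2]
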